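/- Write $Q=[-\tfrac12,\tfrac12]^2$, $\Delta u=u_{xx}+u_{yy}$ and $[a,b]=\tfrac12 a_{xx}b_{yy}+\tfrac12 a_{yy}b_{xx}-a_{xy}b_{xy}$. There exist two families $(w_\delta)_{\delta>0}$, $(\varphi_\delta)_{\delta>0}$ of $C^\infty$ functions $\mathbb R^2\to\mathbb R$, all $1$-periodic in $x$ and in $y$, such that for every $\delta>0$ $$\Delta^2\varphi_\delta+[w_\delta,w_\delta]+(w_\delta)_{xx}=0\quad\text{on }\mathbb R^2,$$ and such that $w_\delta$ and $\varphi_\delta$ satisfy the boundary conditions of the von Kármán–Donnell problem on $Q$: each $u\in\{w_\delta,\varphi_\delta\}$ is periodic in $y$ (with period $1$) and satisfies $u_x=(\Delta u)_x=0$ at $x=\pm\tfrac12$. Moreover, as $\delta\downarrow0$, $$\int_Q (w_\delta)_x^2\to c\ \text{ for some constant } c\in(0,\infty),\qquad \int_Q(\Delta w_\delta)^2=O(\delta^{-1}),$$ and, for every $\alpha>0$, $$\int_Q(\Delta\varphi_\delta)^2=O(\delta^{2-\alpha}),$$ where the implied constant may depend on $\alpha$ (but the families $w_\delta,\varphi_\delta$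 do not). -/

import Mathlib

open Filter Topology Asymptotics MeasureTheory
open scoped ContDiff

namespace VonKarmanDonnell

/-- The partial derivative `u_x` (first coordinate) of a function on the plane. -/
noncomputable def dx (u : ℝ × ℝ → ℝ) : ℝ × ℝ → ℝ :=
  fun p => deriv (fun s => u (s, p.2)) p.1

/-- The partial derivative `u_y` (second coordinate) of a function on the plane. -/
noncomputable def dy (u : ℝ × ℝ → ℝ) : ℝ × ℝ → ℝ :=
  fun p => deriv (fun t => u (p.1, t)) p.2

/-- The Laplacian `Δu = u_xx + u_yy`. -/
noncomputable def lap (u : ℝ × ℝ → ℝ) : ℝ × ℝ → ℝ :=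
  fun p => dx (dx u) p + dy (dy u) p

/-- The bracket `[a,b] = (1/2) a_xx b_yy + (1/2) a_yy b_xx - a_xy b_xy`. -/
noncomputable def bracket (a b : ℝ × ℝ → ℝ) : ℝ × ℝ → ℝ :=
  fun p => (1 / 2) * dx (dx a) p * dy (dy b) p + (1 / 2) * dy (dy a) p * dx (dx b) p
    - dy (dx a) p * dy (dx b) p

/-- `u` is periodic with period `1` in each of the two coordinate directions. -/
def OnePeriodic (u : ℝ × ℝ → ℝ) : Prop :=
  ∀ x y : ℝ, u (x + 1, y) = u (x, y) ∧ u (x, y + 1) = u (x, y)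

/-- The equation `Δ²φ + [w,w] + w_xx = 0`, pointwise on the plane. -/
def SolvesAiry (w φ : ℝ × ℝ → ℝ) : Prop :=
  ∀ p : ℝ × ℝ, lap (lap φ) p + bracket w w p + dx (dx w) p = 0

/-- The boundary conditions on the square `[-1/2,1/2]²`: `u` is periodic in `y` (with period `1`,
the side of the square), and `u_x = (Δu)_x = 0` on the two sides `x = ±1/2`. -/
def BoundaryConditions (u : ℝ × ℝ → ℝ) : Prop :=
  (∀ x y : ℝ, u (x, y + 1) = u (x, y)) ∧
  (∀ y : ℝ, dx u (-(1 / 2), y) = 0 ∧ dx u (1 / 2, y) = 0) ∧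
  (∀ y : ℝ, dx (lap u) (-(1 / 2), y) = 0 ∧ dx (lap u) (1 / 2, y) = 0)

/-- The closed square `[-1/2,1/2]²`. -/
def square : Set (ℝ × ℝ) := Set.Icc (-(1 / 2)) (1 / 2) ×ˢ Set.Icc (-(1 / 2)) (1 / 2)

end VonKarmanDonnell

/-! The operator `[w,w] + w_xx` is the Hessian determinant of `W = w + y²/2`, so `W` should be
nearly developable. Take `f = creaseLine` and fold along the two curved families `y = -f(x)` and `y
= 1/2 + f(x)` modulo 1. Between the creases `W` is `±f(x)/4` plus an affine function of `y`, with
the sign changing at each crease, and its Hessian determinant vanishes.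

Smooth the folds at width `d` with a bump `q`. With `a = y + f` and `b = y - 1/2 - f` one gets `w_x
= f' R` and `w_yy + 1 = q(a) + q(b)`, where `R` (`facetSign`) is `±1/4` away from the creases. Then
`[w,w] + w_xx = f'' R (q(a) + q(b)) + 4 f'² q(a) q(b)`, and the last term is zero because distinct
creases do not overlap (`bracket_deflection_add`). Across a crease `R` is odd and `q` even, so `q R`
has mean zero there. Its primitive (`creaseCurvInt`) is therefore bounded and lives on a set of
measure `O(d)`, and a periodic second primitive (`creasePotential`) is `O(d)` uniformly. The defect
is thus `-g_yy` with `g = airyLoad` of size `O(d)`.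

A Fourier series solves `Δ²φ = g_yy` on the torus, and an energy estimate gives `‖Δφ‖ ≤ ‖g‖` in `L²`
(`exists_biharmonic_solution`). Hence the stretching energy is `O(d²)`, without any loss `α`. The
bending energy is `O(1/d)` since `q` has height `O(1/d)` and fixed mass, and `∫ w_x²` tends to
`(1/16) ∫ f'² = π²/512` since `R² = 1/16` off the creases. The boundary conditions at `x = ±1/2`
follow from evenness in `x` together with periodicity. -/

namespace VonKarmanDonnell

/-! ### Calculus and integration by parts for periodic functions on the plane -/

section PlaneCalculus

variable {u v : ℝ × ℝ → ℝ}

theorem hasDerivAt_dx (hu : ContDiff ℝ ∞ u) (p : ℝ × ℝ) :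
    HasDerivAt (fun s => u (s, p.2)) (fderiv ℝ u p (1, 0)) p.1 := by
  have h := ((hu.differentiable (by simp)) p).hasFDerivAt
  have h2 : HasDerivAt (fun s : ℝ => (s, p.2)) ((1 : ℝ), (0 : ℝ)) p.1 :=
    (hasDerivAt_id p.1).prodMk (hasDerivAt_const p.1 p.2)
  exact HasFDerivAt.comp_hasDerivAt p.1 (by simpa using h) h2

theorem hasDerivAt_dy (hu : ContDiff ℝ ∞ u) (p : ℝ × ℝ) :
    HasDerivAt (fun t => u (p.1, t)) (fderiv ℝ u p (0, 1)) p.2 := by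
  have h := ((hu.differentiable (by simp)) p).hasFDerivAt
  have h2 : HasDerivAt (fun t : ℝ => (p.1, t)) ((0 : ℝ), (1 : ℝ)) p.2 :=
    (hasDerivAt_const p.2 p.1).prodMk (hasDerivAt_id p.2)
  exact HasFDerivAt.comp_hasDerivAt p.2 (by simpa using h) h2

theorem dx_eq_fderiv (hu : ContDiff ℝ ∞ u) : dx u = fun p => fderiv ℝ u p (1, 0) :=
  funext fun p => (hasDerivAt_dx hu p).deriv

theorem dy_eq_fderiv (hu : ContDiff ℝ ∞ u) : dy u = fun p => fderiv ℝ u p (0, 1) :=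
  funext fun p => (hasDerivAt_dy hu p).deriv

theorem contDiff_dx (hu : ContDiff ℝ ∞ u) : ContDiff ℝ ∞ (dx u) := by
  rw [dx_eq_fderiv hu]
  exact (hu.fderiv_right (m := ∞) (by simp)).clm_apply contDiff_const

theorem contDiff_dy (hu : ContDiff ℝ ∞ u) : ContDiff ℝ ∞ (dy u) := by
  rw [dy_eq_fderiv hu]
  exact (hu.fderiv_right (m := ∞) (by simp)).clm_apply contDiff_const

theorem contDiff_lap (hu : ContDiff ℝ ∞ u) : ContDiff ℝ ∞ (lap u) :=
  (contDiff_dx (contDiff_dx hu)).add (contDiff_dy (contDiff_dy hu))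

theorem dx_dy_comm (hu : ContDiff ℝ ∞ u) : dx (dy u) = dy (dx u) := by
  rw [dx_eq_fderiv (contDiff_dy hu), dy_eq_fderiv (contDiff_dx hu), dx_eq_fderiv hu,
    dy_eq_fderiv hu]
  funext p
  have hd : DifferentiableAt ℝ (fderiv ℝ u) p :=
    (hu.fderiv_right (m := ∞) (by simp)).differentiable (by simp) p
  rw [fderiv_clm_apply hd (by fun_prop), fderiv_clm_apply hd (by fun_prop)]
  have hs : IsSymmSndFDerivAt ℝ u p := hu.contDiffAt.isSymmSndFDerivAt (by
    rw [minSmoothness_of_isRCLikeNormedField]; exact WithTop.coe_le_coe.2 le_top)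
  simpa using hs.eq (1, 0) (0, 1)

theorem dx_mul (hu : ContDiff ℝ ∞ u) (hv : ContDiff ℝ ∞ v) :
    dx (fun p => u p * v p) = fun p => dx u p * v p + u p * dx v p := by
  funext p
  have h1 := hasDerivAt_dx hu p
  have h2 := hasDerivAt_dx hv p
  have h3 := (h1.mul h2).deriv
  rw [← h1.deriv, ← h2.deriv] at h3
  exact h3

theorem dy_mul (hu : ContDiff ℝ ∞ u) (hv : ContDiff ℝ ∞ v) :
    dy (fun p => u p * v p) = fun p => dy u p * v p + u p * dy v p := by
  funext p
  have h1 := hasDerivAt_dy hu p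
  have h2 := hasDerivAt_dy hv p
  have h3 := (h1.mul h2).deriv
  rw [← h1.deriv, ← h2.deriv] at h3
  exact h3

namespace OnePeriodic

theorem dx (hu : OnePeriodic u) : OnePeriodic (dx u) := by
  refine fun x y => ⟨?_, ?_⟩
  · have : (fun s => u (s + 1, y)) = fun s => u (s, y) := funext fun s => (hu s y).1
    simpa [VonKarmanDonnell.dx, this] using
      (deriv_comp_add_const (fun s => u (s, y)) 1 x).symm
  · simp [VonKarmanDonnell.dx, (hu _ _).2]

theorem dy (hu : OnePeriodic u) : OnePeriodic (dy u) := by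
  refine fun x y => ⟨?_, ?_⟩
  · simp [VonKarmanDonnell.dy, (hu _ _).1]
  · have : (fun s => u (x, s + 1)) = fun s => u (x, s) := funext fun s => (hu x s).2
    simpa [VonKarmanDonnell.dy, this] using
      (deriv_comp_add_const (fun s => u (x, s)) 1 y).symm

theorem lap (hu : OnePeriodic u) : OnePeriodic (lap u) := fun x y => by
  simp [VonKarmanDonnell.lap, (hu.dx.dx x y).1, (hu.dy.dy x y).1, (hu.dx.dx x y).2,
    (hu.dy.dy x y).2]

theorem mul (hu : OnePeriodic u) (hv : OnePeriodic v) : OnePeriodic fun p => u p * v p :=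
  fun x y => by simp [(hu x y).1, (hu x y).2, (hv x y).1, (hv x y).2]

theorem add_int (hu : OnePeriodic u) (x y : ℝ) (m n : ℤ) : u (x + m, y + n) = u (x, y) := by
  have h1 : Function.Periodic (fun s => u (s, y + n)) 1 := fun s => (hu s _).1
  have h2 : Function.Periodic (fun t => u (x, t)) 1 := fun t => (hu x t).2
  have e1 := h1.int_mul m x
  have e2 := h2.int_mul n y
  simp only [mul_one] at e1 e2
  rw [e1, e2]

end OnePeriodic

/-- `u` is even in the first coordinate. -/
def EvenX (u : ℝ × ℝ → ℝ) : Prop := ∀ x y : ℝ, u (-x, y) = u (x, y)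

theorem EvenX.dx_neg (hu : EvenX u) (x y : ℝ) : dx u (-x, y) = -dx u (x, y) := by
  have : (fun s => u (-s, y)) = fun s => u (s, y) := funext fun s => hu s y
  have h := deriv_comp_neg (fun s => u (s, y)) x
  rw [this] at h
  simp [dx, h]

theorem EvenX.lap (hu : EvenX u) : EvenX (lap u) := by
  intro x y
  have h1 : dx (dx u) (-x, y) = dx (dx u) (x, y) := by
    have : (fun s => dx u (-s, y)) = fun s => -dx u (s, y) := funext fun s => hu.dx_neg s y
    have h := deriv_comp_neg (fun s => dx u (s, y)) x
    rw [this] at h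
    simp only [deriv.fun_neg] at h
    simp [dx] at h ⊢
    exact h.symm
  have h2 : dy (dy u) (-x, y) = dy (dy u) (x, y) := by
    simp [dy, hu _ _]
  simp [VonKarmanDonnell.lap, h1, h2]

/-- The derivative is odd and 1-periodic in `x`, so its values at `±1/2` are both equal and
opposite. -/
theorem dx_half_eq_zero (hp : OnePeriodic u) (he : EvenX u) (y : ℝ) :
    dx u (-(1 / 2), y) = 0 ∧ dx u (1 / 2, y) = 0 := by
  have h1 := he.dx_neg (1 / 2) y
  have h2 := (hp.dx (-(1 / 2)) y).1
  norm_num at h1 h2 ⊢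
  constructor <;> linarith

theorem boundaryConditions_of_even (hp : OnePeriodic u) (he : EvenX u) : BoundaryConditions u :=
  ⟨fun x y => (hp x y).2, dx_half_eq_zero hp he, dx_half_eq_zero hp.lap he.lap⟩

theorem isCompact_square : IsCompact square := isCompact_Icc.prod isCompact_Icc

theorem integrableOn_square (hu : Continuous u) : IntegrableOn u square :=
  hu.continuousOn.integrableOn_compact isCompact_square

theorem integral_square (hu : Continuous u) :
    ∫ p in square, u p =
      ∫ x in (-(1 / 2) : ℝ)..(1 / 2), ∫ y in (-(1 / 2) : ℝ)..(1 / 2), u (x, y) := by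
  rw [square, Measure.volume_eq_prod, setIntegral_prod _
    (by simpa [← Measure.volume_eq_prod, square] using integrableOn_square hu),
    intervalIntegral.integral_of_le (by norm_num), integral_Icc_eq_integral_Ioc]
  refine integral_congr_ae (ae_of_all _ fun x => ?_)
  simp only
  rw [intervalIntegral.integral_of_le (by norm_num), integral_Icc_eq_integral_Ioc]

theorem integral_square_swap (hu : Continuous u) :
    ∫ p in square, u p =
      ∫ y in (-(1 / 2) : ℝ)..(1 / 2), ∫ x in (-(1 / 2) : ℝ)..(1 / 2), u (x, y) := by
  rw [integral_square hu, intervalIntegral_intervalIntegral_swap]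
  have : IntegrableOn u square := integrableOn_square hu
  rw [Set.uIoc_of_le (by norm_num)]
  exact this.mono_set (Set.prod_mono Set.Ioc_subset_Icc_self Set.Ioc_subset_Icc_self)

theorem integral_dx_eq_zero (hu : ContDiff ℝ ∞ u) (hp : OnePeriodic u) :
    ∫ p in square, dx u p = 0 := by
  rw [integral_square_swap (contDiff_dx hu).continuous]
  refine (intervalIntegral.integral_congr fun y _ => ?_).trans intervalIntegral.integral_zero
  rw [intervalIntegral.integral_eq_sub_of_hasDerivAt (f := fun x => u (x, y))]
  · have := (hp (-(1 / 2)) y).1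
    norm_num at this ⊢
    linarith
  · intro x _
    simpa [dx_eq_fderiv hu] using hasDerivAt_dx hu (x, y)
  · exact ((contDiff_dx hu).continuous.comp (by fun_prop)).intervalIntegrable _ _

theorem integral_dy_eq_zero (hu : ContDiff ℝ ∞ u) (hp : OnePeriodic u) :
    ∫ p in square, dy u p = 0 := by
  rw [integral_square (contDiff_dy hu).continuous]
  refine (intervalIntegral.integral_congr fun x _ => ?_).trans intervalIntegral.integral_zero
  rw [intervalIntegral.integral_eq_sub_of_hasDerivAt (f := fun y => u (x, y))]
  · have := (hp x (-(1 / 2))).2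
    norm_num at this ⊢
    linarith
  · intro y _
    simpa [dy_eq_fderiv hu] using hasDerivAt_dy hu (x, y)
  · exact ((contDiff_dy hu).continuous.comp (by fun_prop)).intervalIntegrable _ _

theorem integral_dx_mul (hu : ContDiff ℝ ∞ u) (hv : ContDiff ℝ ∞ v) (hpu : OnePeriodic u)
    (hpv : OnePeriodic v) :
    ∫ p in square, dx u p * v p = -∫ p in square, u p * dx v p := by
  have h := integral_dx_eq_zero (hu.mul hv) (hpu.mul hpv)
  rw [dx_mul hu hv, integral_add (integrableOn_square ((contDiff_dx hu).mul hv).continuous)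
    (integrableOn_square (hu.mul (contDiff_dx hv)).continuous)] at h
  linarith

theorem integral_dy_mul (hu : ContDiff ℝ ∞ u) (hv : ContDiff ℝ ∞ v) (hpu : OnePeriodic u)
    (hpv : OnePeriodic v) :
    ∫ p in square, dy u p * v p = -∫ p in square, u p * dy v p := by
  have h := integral_dy_eq_zero (hu.mul hv) (hpu.mul hpv)
  rw [dy_mul hu hv, integral_add (integrableOn_square ((contDiff_dy hu).mul hv).continuous)
    (integrableOn_square (hu.mul (contDiff_dy hv)).continuous)] at h
  linarith

theorem integral_dx_dx_mul (hu : ContDiff ℝ ∞ u) (hv : ContDiff ℝ ∞ v) (hpu : OnePeriodic u)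
    (hpv : OnePeriodic v) :
    ∫ p in square, dx (dx u) p * v p = ∫ p in square, u p * dx (dx v) p := by
  rw [integral_dx_mul (contDiff_dx hu) hv hpu.dx hpv,
    integral_dx_mul hu (contDiff_dx hv) hpu hpv.dx, neg_neg]

theorem integral_dy_dy_mul (hu : ContDiff ℝ ∞ u) (hv : ContDiff ℝ ∞ v) (hpu : OnePeriodic u)
    (hpv : OnePeriodic v) :
    ∫ p in square, dy (dy u) p * v p = ∫ p in square, u p * dy (dy v) p := by
  rw [integral_dy_mul (contDiff_dy hu) hv hpu.dy hpv,
    integral_dy_mul hu (contDiff_dy hv) hpu hpv.dy, neg_neg]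

theorem integral_lap_mul (hu : ContDiff ℝ ∞ u) (hv : ContDiff ℝ ∞ v) (hpu : OnePeriodic u)
    (hpv : OnePeriodic v) :
    ∫ p in square, lap u p * v p = ∫ p in square, u p * lap v p := by
  simp only [lap, add_mul, mul_add]
  rw [integral_add (integrableOn_square ((contDiff_dx (contDiff_dx hu)).mul hv).continuous)
      (integrableOn_square ((contDiff_dy (contDiff_dy hu)).mul hv).continuous),
    integral_add (integrableOn_square (hu.mul (contDiff_dx (contDiff_dx hv))).continuous)
      (integrableOn_square (hu.mul (contDiff_dy (contDiff_dy hv))).continuous),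
    integral_dx_dx_mul hu hv hpu hpv, integral_dy_dy_mul hu hv hpu hpv]

/-- The second derivative `u_yy` is controlled in `L²` by the Laplacian. -/
theorem integral_dy_dy_sq_le (hu : ContDiff ℝ ∞ u) (hp : OnePeriodic u) :
    ∫ p in square, dy (dy u) p ^ 2 ≤ ∫ p in square, lap u p ^ 2 := by
  have cxx := contDiff_dx (contDiff_dx hu)
  have cyy := contDiff_dy (contDiff_dy hu)
  have cxy := contDiff_dy (contDiff_dx hu)
  -- Two integrations by parts turn the mixed term of `(Δu)²` into a square, so dropping it together
  -- with `u_xx²` only decreases the integral.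
  have hcross : ∫ p in square, dx (dx u) p * dy (dy u) p = ∫ p in square, dy (dx u) p ^ 2 := by
    rw [integral_dx_mul (contDiff_dx hu) cyy hp.dx hp.dy.dy, dx_dy_comm (contDiff_dy hu),
      dx_dy_comm hu]
    have := integral_dy_mul (contDiff_dx hu) cxy hp.dx hp.dx.dy
    simp only [pow_two]
    linarith
  have hcross0 : 0 ≤ ∫ p in square, dx (dx u) p * dy (dy u) p :=
    hcross ▸ integral_nonneg fun p => sq_nonneg _
  have hxx : 0 ≤ ∫ p in square, dx (dx u) p ^ 2 := integral_nonneg fun p => sq_nonneg _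
  have e : ∀ p, lap u p ^ 2
      = dx (dx u) p ^ 2 + (2 * (dx (dx u) p * dy (dy u) p) + dy (dy u) p ^ 2) := fun p => by
    simp only [lap]; ring
  simp only [e]
  rw [integral_add (integrableOn_square (cxx.pow 2).continuous)
      (integrableOn_square ((contDiff_const.mul (cxx.mul cyy)).add (cyy.pow 2)).continuous),
    integral_add (integrableOn_square (contDiff_const.mul (cxx.mul cyy)).continuous)
      (integrableOn_square (cyy.pow 2).continuous), integral_const_mul]
  linarith

/-- The energy estimate for `Δ²φ = g_yy`. -/
theorem integral_lap_sq_le_of_biharmonic {φ g : ℝ × ℝ → ℝ} (hφ : ContDiff ℝ ∞ φ)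
    (hg : ContDiff ℝ ∞ g) (hpφ : OnePeriodic φ) (hpg : OnePeriodic g)
    (h : lap (lap φ) = dy (dy g)) :
    ∫ p in square, lap φ p ^ 2 ≤ ∫ p in square, g p ^ 2 := by
  have h1 : ∫ p in square, lap φ p ^ 2 = ∫ p in square, dy (dy φ) p * g p := by
    have := integral_lap_mul hφ (contDiff_lap hφ) hpφ hpφ.lap
    rw [h, ← integral_dy_dy_mul hφ hg hpφ hpg] at this
    rw [← this]
    simp only [pow_two]
  have cyy := contDiff_dy (contDiff_dy hφ)
  -- Young's inequality with weights `1/2`; the `φ_yy` half is absorbed into the left side through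
  -- `integral_dy_dy_sq_le`, leaving constant 1.
  have h2 : ∫ p in square, dy (dy φ) p * g p
      ≤ ∫ p in square, ((1 / 2) * dy (dy φ) p ^ 2 + (1 / 2) * g p ^ 2) := by
    refine integral_mono (integrableOn_square (cyy.mul hg).continuous)
      (integrableOn_square ((contDiff_const.mul (cyy.pow 2)).add
        (contDiff_const.mul (hg.pow 2))).continuous) fun p => ?_
    simp only
    nlinarith [sq_nonneg (dy (dy φ) p - g p)]
  rw [integral_add (integrableOn_square (contDiff_const.mul (cyy.pow 2)).continuous)
    (integrableOn_square (contDiff_const.mul (hg.pow 2)).continuous), integral_const_mul,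
    integral_const_mul] at h2
  have h3 := integral_dy_dy_sq_le hφ hpφ
  linarith

end PlaneCalculus

/-! ### Trigonometric series with rapidly decaying coefficients -/

section TrigonometricSeries

open Real

/-- The squared length of a frequency. -/
def freqSq (k : Fin 2 → ℤ) : ℝ := (k 0 : ℝ) ^ 2 + (k 1 : ℝ) ^ 2

theorem freqSq_nonneg (k : Fin 2 → ℤ) : 0 ≤ freqSq k := by unfold freqSq; positivity

/-- The linear form `p ↦ 2π k·p`. -/
noncomputable def phase (k : Fin 2 → ℤ) : ℝ × ℝ →L[ℝ] ℝ :=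
  (2 * π * k 0) • ContinuousLinearMap.fst ℝ ℝ ℝ + (2 * π * k 1) • ContinuousLinearMap.snd ℝ ℝ ℝ

theorem phase_apply (k : Fin 2 → ℤ) (p : ℝ × ℝ) :
    phase k p = 2 * π * k 0 * p.1 + 2 * π * k 1 * p.2 := by
  simp [phase]

theorem abs_freq_le (k : Fin 2 → ℤ) (i : Fin 2) : |(k i : ℝ)| ≤ 1 + freqSq k := by
  have h : |(k i : ℝ)| ≤ 1 + |(k i : ℝ)| ^ 2 := by
    nlinarith [sq_nonneg (|(k i : ℝ)| - 1), abs_nonneg (k i : ℝ)]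
  rw [sq_abs] at h
  unfold freqSq
  fin_cases i
  · exact h.trans (by simp; positivity)
  · exact h.trans (by simp; positivity)

theorem norm_phase_le (k : Fin 2 → ℤ) : ‖phase k‖ ≤ 4 * π * (1 + freqSq k) := by
  have h : ∀ i, ‖2 * π * (k i : ℝ)‖ ≤ 2 * π * (1 + freqSq k) := fun i => by
    rw [norm_mul, Real.norm_of_nonneg (by positivity), Real.norm_eq_abs]
    exact mul_le_mul_of_nonneg_left (abs_freq_le k i) (by positivity)
  calc ‖phase k‖ ≤ ‖2 * π * (k 0 : ℝ)‖ * 1 + ‖2 * π * (k 1 : ℝ)‖ * 1 := by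
        refine (norm_add_le _ _).trans (add_le_add ?_ ?_)
        · rw [norm_smul]
          exact mul_le_mul_of_nonneg_left (ContinuousLinearMap.norm_fst_le ℝ ℝ ℝ) (norm_nonneg _)
        · rw [norm_smul]
          exact mul_le_mul_of_nonneg_left (ContinuousLinearMap.norm_snd_le ℝ ℝ ℝ) (norm_nonneg _)
    _ ≤ _ := by linarith [h 0, h 1]

/-- The wave `cos (2π k·p + τ)`. -/
noncomputable def wave (τ : ℝ) (k : Fin 2 → ℤ) (p : ℝ × ℝ) : ℝ := cos (phase k p + τ)

theorem contDiff_wave (τ : ℝ) (k : Fin 2 → ℤ) : ContDiff ℝ ∞ (wave τ k) :=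
  contDiff_cos.comp ((phase k).contDiff.add contDiff_const)

theorem onePeriodic_wave (τ : ℝ) (k : Fin 2 → ℤ) : OnePeriodic (wave τ k) := by
  intro x y
  have h0 := cos_periodic.int_mul (k 0) (phase k (x, y) + τ)
  have h1 := cos_periodic.int_mul (k 1) (phase k (x, y) + τ)
  constructor
  · unfold wave
    rw [← h0]
    congr 1
    simp only [phase_apply]
    ring
  · unfold wave
    rw [← h1]
    congr 1
    simp only [phase_apply]
    ring

/-- Differentiation advances the phase by `π/2`, so the family indexed by `τ` is closed under
derivatives and sines need no separate treatment. -/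
theorem hasDerivAt_wave_fst (τ : ℝ) (k : Fin 2 → ℤ) (x y : ℝ) :
    HasDerivAt (fun s => wave τ k (s, y)) (2 * π * k 0 * wave (τ + π / 2) k (x, y)) x := by
  have h : HasDerivAt (fun s : ℝ => 2 * π * k 0 * s + 2 * π * k 1 * y + τ) (2 * π * k 0) x := by
    simpa using (((hasDerivAt_id x).const_mul (2 * π * (k 0 : ℝ))).add_const
      (2 * π * k 1 * y)).add_const τ
  have h2 := h.cos
  simp only [wave, phase_apply, ← add_assoc, cos_add_pi_div_two]
  convert! h2 using 1
  ring

theorem hasDerivAt_wave_snd (τ : ℝ) (k : Fin 2 → ℤ) (x y : ℝ) :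
    HasDerivAt (fun t => wave τ k (x, t)) (2 * π * k 1 * wave (τ + π / 2) k (x, y)) y := by
  have h : HasDerivAt (fun t : ℝ => 2 * π * k 0 * x + 2 * π * k 1 * t + τ) (2 * π * k 1) y := by
    simpa using (((hasDerivAt_id y).const_mul (2 * π * (k 1 : ℝ))).const_add
      (2 * π * k 0 * x)).add_const τ
  have h2 := h.cos
  simp only [wave, phase_apply, ← add_assoc, cos_add_pi_div_two]
  convert! h2 using 1
  ring

theorem wave_add_pi (τ : ℝ) (k : Fin 2 → ℤ) (p : ℝ × ℝ) :
    wave (τ + π / 2 + π / 2) k p = -wave τ k p := by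
  unfold wave
  rw [← cos_add_pi]
  congr 1
  ring

theorem lap_wave (τ : ℝ) (k : Fin 2 → ℤ) :
    lap (wave τ k) = fun p => -(4 * π ^ 2 * freqSq k) * wave τ k p := by
  have h1 : ∀ τ, dx (wave τ k) = fun p => 2 * π * k 0 * wave (τ + π / 2) k p := fun τ =>
    funext fun p => (hasDerivAt_wave_fst τ k p.1 p.2).deriv
  have h2 : ∀ τ, dy (wave τ k) = fun p => 2 * π * k 1 * wave (τ + π / 2) k p := fun τ =>
    funext fun p => (hasDerivAt_wave_snd τ k p.1 p.2).deriv
  funext p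
  unfold lap
  rw [h1, h2]
  have e1 := ((hasDerivAt_wave_fst (τ + π / 2) k p.1 p.2).const_mul (2 * π * (k 0 : ℝ))).deriv
  have e2 := ((hasDerivAt_wave_snd (τ + π / 2) k p.1 p.2).const_mul (2 * π * (k 1 : ℝ))).deriv
  simp only [dx, dy, e1, e2, wave_add_pi, freqSq]
  ring

theorem abs_wave_le (τ : ℝ) (k : Fin 2 → ℤ) (p : ℝ × ℝ) : |wave τ k p| ≤ 1 := abs_cos_le_one _

theorem norm_iteratedDeriv_cos_add_le (n : ℕ) (τ x : ℝ) :
    ‖iteratedDeriv n (fun t => cos (t + τ)) x‖ ≤ 1 := by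
  induction n generalizing τ with
  | zero => simpa using abs_cos_le_one (x + τ)
  | succ n ih =>
    have : deriv (fun t => cos (t + τ)) = fun t => cos (t + (τ + π / 2)) := by
      funext t
      rw [← add_assoc, cos_add_pi_div_two]
      simp
    rw [iteratedDeriv_succ', this]
    exact ih _

theorem norm_iteratedFDeriv_wave_le (n : ℕ) (τ : ℝ) (k : Fin 2 → ℤ) (p : ℝ × ℝ) :
    ‖iteratedFDeriv ℝ n (wave τ k) p‖ ≤ (4 * π * (1 + freqSq k)) ^ n := by
  have hc : ContDiff ℝ ∞ fun t => cos (t + τ) := contDiff_cos.comp (contDiff_id.add contDiff_const)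
  have : wave τ k = (fun t => cos (t + τ)) ∘ phase k := rfl
  rw [this, (phase k).iteratedFDeriv_comp_right hc p (WithTop.coe_le_coe.2 le_top)]
  refine (ContinuousMultilinearMap.norm_compContinuousLinearMap_le _ _).trans ?_
  rw [norm_iteratedFDeriv_eq_norm_iteratedDeriv, Finset.prod_const, Finset.card_univ,
    Fintype.card_fin, ← one_mul ((4 * π * (1 + freqSq k)) ^ n)]
  exact mul_le_mul (norm_iteratedDeriv_cos_add_le n τ _)
    (pow_le_pow_left₀ (norm_nonneg _) (norm_phase_le k) n) (by positivity) zero_le_one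

/-- Faster than polynomial decay of a family of coefficients. -/
def RapidDecay (A : (Fin 2 → ℤ) → ℝ) : Prop :=
  ∀ N : ℕ, ∃ C, ∀ k, |A k| * (1 + freqSq k) ^ N ≤ C

/-- Since `(1 + |k|²)² ≥ (1 + k₀²)(1 + k₁²)`, the sum is dominated by a product of two convergent
one-dimensional sums. -/
theorem summable_inv_one_add_freqSq_sq :
    Summable fun k : Fin 2 → ℤ => ((1 + freqSq k) ^ 2)⁻¹ := by
  have h1 : Summable fun n : ℤ => (1 + (n : ℝ) ^ 2)⁻¹ := by
    have h0 : Summable fun n : ℤ => 1 / (n : ℝ) ^ 2 := Real.summable_one_div_int_pow.2 one_lt_two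
    have h00 : Summable fun n : ℤ => if n = 0 then (1 : ℝ) else 0 :=
      summable_of_ne_finset_zero (s := {0}) (by simp)
    refine Summable.of_nonneg_of_le (fun n => by positivity) (fun n => ?_) (h0.add h00)
    by_cases hn : n = 0
    · simp [hn]
    · have : 0 < (n : ℝ) ^ 2 := by positivity
      simp only [hn, if_false, add_zero, one_div]
      exact inv_anti₀ this (by linarith)
  have h2 := h1.mul_of_nonneg h1 (fun n => by positivity) fun n => by positivity
  rw [← (finTwoArrowEquiv ℤ).summable_iff] at h2
  refine Summable.of_nonneg_of_le (fun k => by have := freqSq_nonneg k; positivity)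
    (fun k => ?_) h2
  simp only [Function.comp_apply, ← mul_inv]
  refine inv_anti₀ (by positivity) ?_
  change (1 + (k 0 : ℝ) ^ 2) * (1 + (k 1 : ℝ) ^ 2) ≤ _
  unfold freqSq
  nlinarith [sq_nonneg (k 0 : ℝ), sq_nonneg (k 1 : ℝ),
    mul_nonneg (sq_nonneg (k 0 : ℝ)) (sq_nonneg (k 1 : ℝ)),
    sq_nonneg ((k 0 : ℝ) ^ 2), sq_nonneg ((k 1 : ℝ) ^ 2)]

namespace RapidDecay

variable {A B : (Fin 2 → ℤ) → ℝ}

theorem summable_mul_pow (hA : RapidDecay A) (N : ℕ) :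
    Summable fun k => |A k| * (1 + freqSq k) ^ N := by
  obtain ⟨C, hC⟩ := hA (N + 2)
  have hk : ∀ k, 0 < 1 + freqSq k := fun k => by linarith [freqSq_nonneg k]
  refine Summable.of_nonneg_of_le (fun k => by have := hk k; positivity) (fun k => ?_)
    (summable_inv_one_add_freqSq_sq.mul_left C)
  have := hC k
  rw [pow_add, ← mul_assoc] at this
  rw [← div_eq_mul_inv, le_div_iff₀ (pow_pos (hk k) 2)]
  exact this

theorem summable (hA : RapidDecay A) : Summable fun k => |A k| := by
  simpa using hA.summable_mul_pow 0

theorem of_abs_le (hA : RapidDecay A) {N : ℕ} {c : ℝ}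
    (h : ∀ k, |B k| ≤ c * (|A k| * (1 + freqSq k) ^ N)) (hc : 0 ≤ c) : RapidDecay B := by
  intro M
  obtain ⟨C, hC⟩ := hA (N + M)
  refine ⟨c * C, fun k => ?_⟩
  have hk : 0 < 1 + freqSq k := by linarith [freqSq_nonneg k]
  calc |B k| * (1 + freqSq k) ^ M ≤ c * (|A k| * (1 + freqSq k) ^ N) * (1 + freqSq k) ^ M :=
        mul_le_mul_of_nonneg_right (h k) (by positivity)
    _ = c * (|A k| * (1 + freqSq k) ^ (N + M)) := by ring
    _ ≤ c * C := mul_le_mul_of_nonneg_left (hC k) hc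

theorem mul_freq (hA : RapidDecay A) (i : Fin 2) : RapidDecay fun k => 2 * π * k i * A k := by
  refine hA.of_abs_le (N := 1) (c := 2 * π) (fun k => ?_) (by positivity)
  rw [abs_mul, abs_mul, abs_of_nonneg (by positivity : 0 ≤ 2 * π)]
  have := mul_le_mul_of_nonneg_left (abs_freq_le k i) (abs_nonneg (A k))
  rw [pow_one, mul_assoc, mul_comm |(k i : ℝ)|]
  exact mul_le_mul_of_nonneg_left this (by positivity)

end RapidDecay

/-- The trigonometric series `∑ A k cos (2π k·p + τ)`. -/
noncomputable def trigSeries (τ : ℝ) (A : (Fin 2 → ℤ) → ℝ) (p : ℝ × ℝ) : ℝ :=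
  ∑' k, A k * wave τ k p

variable {A : (Fin 2 → ℤ) → ℝ}

theorem norm_mul_wave_le (τ : ℝ) (k : Fin 2 → ℤ) (p : ℝ × ℝ) : ‖A k * wave τ k p‖ ≤ |A k| := by
  rw [norm_mul, Real.norm_eq_abs, Real.norm_eq_abs]
  exact mul_le_of_le_one_right (abs_nonneg _) (abs_wave_le τ k p)

theorem contDiff_trigSeries (hA : RapidDecay A) (τ : ℝ) : ContDiff ℝ ∞ (trigSeries τ A) := by
  refine contDiff_tsum (N := ⊤) (v := fun n k => (4 * π) ^ n * (|A k| * (1 + freqSq k) ^ n))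
    (fun k => contDiff_const.mul (contDiff_wave τ k))
    (fun n _ => (hA.summable_mul_pow n).mul_left _) fun n k p _ => ?_
  have h : iteratedFDeriv ℝ n (fun p => A k * wave τ k p) p
      = A k • iteratedFDeriv ℝ n (wave τ k) p :=
    iteratedFDeriv_const_smul_apply' (a := A k) ((contDiff_wave τ k).of_le
      (WithTop.coe_le_coe.2 le_top)).contDiffAt
  rw [h, norm_smul, Real.norm_eq_abs]
  refine (mul_le_mul_of_nonneg_left (norm_iteratedFDeriv_wave_le n τ k p)
    (abs_nonneg _)).trans_eq ?_
  rw [mul_pow]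
  ring

theorem onePeriodic_trigSeries (τ : ℝ) (A : (Fin 2 → ℤ) → ℝ) : OnePeriodic (trigSeries τ A) :=
  fun x y => by simp [trigSeries, (onePeriodic_wave _ _ x y).1, (onePeriodic_wave _ _ x y).2]

theorem dx_trigSeries (hA : RapidDecay A) (τ : ℝ) :
    dx (trigSeries τ A) = trigSeries (τ + π / 2) fun k => 2 * π * k 0 * A k := by
  funext p
  refine (hasDerivAt_tsum (hA.mul_freq 0).summable (fun k x =>
    ((hasDerivAt_wave_fst τ k x p.2).const_mul (A k)).congr_deriv
      (g' := 2 * π * k 0 * A k * wave (τ + π / 2) k (x, p.2)) (by ring))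
    (fun k x => norm_mul_wave_le (A := fun k => 2 * π * k 0 * A k) _ _ _) (y₀ := 0)
      (Summable.of_norm_bounded hA.summable fun k => norm_mul_wave_le _ _ _) p.1).deriv

theorem dy_trigSeries (hA : RapidDecay A) (τ : ℝ) :
    dy (trigSeries τ A) = trigSeries (τ + π / 2) fun k => 2 * π * k 1 * A k := by
  funext p
  refine (hasDerivAt_tsum (hA.mul_freq 1).summable (fun k y =>
    ((hasDerivAt_wave_snd τ k p.1 y).const_mul (A k)).congr_deriv
      (g' := 2 * π * k 1 * A k * wave (τ + π / 2) k (p.1, y)) (by ring))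
    (fun k x => norm_mul_wave_le (A := fun k => 2 * π * k 1 * A k) _ _ _) (y₀ := 0)
      (Summable.of_norm_bounded hA.summable fun k => norm_mul_wave_le _ _ _) p.2).deriv

theorem trigSeries_add_pi (τ : ℝ) (A : (Fin 2 → ℤ) → ℝ) :
    trigSeries (τ + π / 2 + π / 2) A = trigSeries τ fun k => -A k := by
  funext p
  simp [trigSeries, wave_add_pi]

theorem dy_dy_trigSeries (hA : RapidDecay A) (τ : ℝ) :
    dy (dy (trigSeries τ A)) = trigSeries τ fun k => -((2 * π * k 1) ^ 2 * A k) := by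
  rw [dy_trigSeries hA, dy_trigSeries (hA.mul_freq 1), trigSeries_add_pi]
  congr 1
  funext k
  ring

theorem lap_trigSeries (hA : RapidDecay A) (τ : ℝ) :
    lap (trigSeries τ A) = trigSeries τ fun k => -(4 * π ^ 2 * freqSq k) * A k := by
  funext p
  unfold lap
  rw [dy_dy_trigSeries hA, dx_trigSeries hA, dx_trigSeries (hA.mul_freq 0), trigSeries_add_pi]
  have s1 : Summable fun k => -(2 * π * k 0 * (2 * π * k 0 * A k)) * wave τ k p :=
    Summable.of_norm_bounded ((hA.mul_freq 0).mul_freq 0).summable fun k => by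
      simpa only [abs_neg] using
        norm_mul_wave_le (A := fun k => -(2 * π * k 0 * (2 * π * k 0 * A k))) τ k p
  have s2 : Summable fun k => -((2 * π * k 1) ^ 2 * A k) * wave τ k p :=
    Summable.of_norm_bounded ((hA.mul_freq 1).mul_freq 1).summable fun k => by
      have := norm_mul_wave_le (A := fun k => -((2 * π * k 1) ^ 2 * A k)) τ k p
      rw [abs_neg] at this
      convert! this using 2
      ring
  simp only [trigSeries]
  rw [← s1.tsum_add s2]
  congr 1
  funext k
  simp only [freqSq]
  ring

/-- Solution of the periodic problem `Δ²φ = g_yy` for one trigonometric series. -/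
theorem lap_lap_trigSeries_eq (hA : RapidDecay A) (τ : ℝ) :
    RapidDecay (fun k => -((2 * π * k 1) ^ 2 * A k) / (4 * π ^ 2 * freqSq k) ^ 2) ∧
    lap (lap (trigSeries τ fun k => -((2 * π * k 1) ^ 2 * A k) / (4 * π ^ 2 * freqSq k) ^ 2))
      = dy (dy (trigSeries τ A)) := by
  have hk1 : ∀ k : Fin 2 → ℤ, (2 * π * (k 1 : ℝ)) ^ 2 ≤ 4 * π ^ 2 * freqSq k := fun k => by
    unfold freqSq
    nlinarith [mul_nonneg (sq_nonneg π) (sq_nonneg (k 0 : ℝ))]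
  -- Integrality leaves a spectral gap: away from the zero frequency the divisor is at least 1, so
  -- dividing by it cannot enlarge the coefficients.
  have hfreq : ∀ k : Fin 2 → ℤ, freqSq k = 0 ∨ 1 ≤ freqSq k := fun k => by
    have e : freqSq k = ((k 0 ^ 2 + k 1 ^ 2 : ℤ) : ℝ) := by simp [freqSq]
    rw [e]
    rcases (by positivity : 0 ≤ k 0 ^ 2 + k 1 ^ 2).eq_or_lt with h | h
    · exact .inl (by exact_mod_cast h.symm)
    · exact .inr (by exact_mod_cast h)
  have hB : RapidDecay fun k => -((2 * π * k 1) ^ 2 * A k) / (4 * π ^ 2 * freqSq k) ^ 2 := by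
    refine hA.of_abs_le (N := 0) (c := 1) (fun k => ?_) zero_le_one
    rw [pow_zero, mul_one, one_mul, abs_div, abs_neg, abs_mul, abs_sq, abs_sq]
    rcases hfreq k with h | h
    · simp [h]
    · have h4 : 1 ≤ 4 * π ^ 2 * freqSq k := by nlinarith [pi_gt_three]
      refine div_le_of_le_mul₀ (by positivity) (abs_nonneg _) ?_
      rw [mul_comm]
      refine mul_le_mul_of_nonneg_left ((hk1 k).trans ?_) (abs_nonneg _)
      nlinarith
  have hL : RapidDecay fun k => -(4 * π ^ 2 * freqSq k) *
      (-((2 * π * k 1) ^ 2 * A k) / (4 * π ^ 2 * freqSq k) ^ 2) := by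
    refine hB.of_abs_le (N := 1) (c := 4 * π ^ 2) (fun k => ?_) (by positivity)
    rw [abs_mul, abs_neg, abs_of_nonneg (by have := freqSq_nonneg k; positivity), pow_one]
    nlinarith [mul_nonneg (sq_nonneg π) (abs_nonneg
      (-((2 * π * k 1) ^ 2 * A k) / (4 * π ^ 2 * freqSq k) ^ 2))]
  refine ⟨hB, ?_⟩
  rw [lap_trigSeries hB, lap_trigSeries hL, dy_dy_trigSeries hA]
  congr 1
  funext k
  -- At the zero frequency the quotient is `0` by the convention for division by zero. The right
  -- side also vanishes there because `k 1 = 0`, which is the solvability condition.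
  rcases hfreq k with h | h
  · have : (2 * π * (k 1 : ℝ)) ^ 2 = 0 := le_antisymm (by simpa [h] using hk1 k) (sq_nonneg _)
    simp [h, this]
  · have : freqSq k ≠ 0 := by linarith
    field_simp

/-- Reflection of frequencies in the first coordinate. -/
def reflectFreq : Equiv.Perm (Fin 2 → ℤ) where
  toFun k := ![-k 0, k 1]
  invFun k := ![-k 0, k 1]
  left_inv k := by ext i; fin_cases i <;> simp
  right_inv k := by ext i; fin_cases i <;> simp

theorem freqSq_reflectFreq (k : Fin 2 → ℤ) : freqSq (reflectFreq k) = freqSq k := by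
  simp [freqSq, reflectFreq]

theorem trigSeries_neg_fst (τ : ℝ) (A : (Fin 2 → ℤ) → ℝ) (x y : ℝ) :
    trigSeries τ A (-x, y) = trigSeries τ (A ∘ reflectFreq) (x, y) := by
  unfold trigSeries
  rw [← reflectFreq.tsum_eq]
  congr 1
  funext k
  simp [wave, phase_apply, reflectFreq]

theorem RapidDecay.comp_reflectFreq (hA : RapidDecay A) : RapidDecay (A ∘ reflectFreq) := by
  intro N
  obtain ⟨C, hC⟩ := hA N
  exact ⟨C, fun k => by simpa [freqSq_reflectFreq] using hC (reflectFreq k)⟩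

end TrigonometricSeries

/-! ### Fourier expansion of smooth periodic functions and the biharmonic equation -/

section FourierExpansion

open Real

variable {g : ℝ × ℝ → ℝ}

/-- Each wave is an eigenfunction of the Laplacian, so one power of the eigenvalue is traded, up to
sign, for one Laplacian on `g`. The bound is uniform in the phase and the frequency. -/
theorem integral_mul_wave_bound (N : ℕ) (hg : ContDiff ℝ ∞ g) (hp : OnePeriodic g) :
    ∃ C, ∀ τ k, |(4 * π ^ 2 * freqSq k) ^ N * ∫ p in square, g p * wave τ k p| ≤ C := by
  induction N generalizing g with
  | zero =>
    refine ⟨∫ p in square, |g p|, fun τ k => ?_⟩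
    rw [pow_zero, one_mul]
    refine (abs_integral_le_integral_abs).trans (integral_mono
      (integrableOn_square (hg.mul (contDiff_wave τ k)).continuous.abs)
      (integrableOn_square hg.continuous.abs) fun p => ?_)
    simp only [abs_mul]
    exact mul_le_of_le_one_right (abs_nonneg _) (abs_wave_le τ k p)
  | succ N ih =>
    obtain ⟨C, hC⟩ := ih (contDiff_lap hg) hp.lap
    refine ⟨C, fun τ k => ?_⟩
    have h := integral_lap_mul hg (contDiff_wave τ k) hp (onePeriodic_wave τ k)
    rw [lap_wave] at h
    have e : ∀ p, g p * (-(4 * π ^ 2 * freqSq k) * wave τ k p)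
        = -(4 * π ^ 2 * freqSq k) * (g p * wave τ k p) := fun p => by ring
    simp only [e] at h
    rw [integral_const_mul] at h
    have := hC τ k
    rw [h] at this
    rw [← abs_neg]
    convert! this using 2
    ring

theorem rapidDecay_integral_mul_wave (hg : ContDiff ℝ ∞ g) (hp : OnePeriodic g) (τ : ℝ) :
    RapidDecay fun k => ∫ p in square, g p * wave τ k p := by
  intro N
  obtain ⟨C0, hC0⟩ := integral_mul_wave_bound 0 hg hp
  obtain ⟨C, hC⟩ := integral_mul_wave_bound N hg hp
  refine ⟨2 ^ (N - 1) * (C0 + C), fun k => ?_⟩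
  have h0 := hC0 τ k
  have h1 := hC τ k
  have hk := freqSq_nonneg k
  rw [pow_zero, one_mul] at h0
  rw [abs_mul, abs_of_nonneg (by positivity)] at h1
  -- Convexity of the power reduces polynomial decay to the two bounds with exponents `0` and `N`.
  have h2 : (1 + freqSq k) ^ N ≤ 2 ^ (N - 1) * (1 + (4 * π ^ 2 * freqSq k) ^ N) := by
    refine (add_pow_le zero_le_one hk N).trans ?_
    rw [one_pow]
    have : freqSq k ≤ 4 * π ^ 2 * freqSq k :=
      le_mul_of_one_le_left hk (by nlinarith [pi_gt_three])
    gcongr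
  have h3 := mul_le_mul_of_nonneg_left h2 (abs_nonneg (∫ p in square, g p * wave τ k p))
  refine h3.trans ?_
  have : (0 : ℝ) < 2 ^ (N - 1) := by positivity
  nlinarith

/-- A continuous `1`-periodic function on the plane descends to the torus. -/
theorem exists_torus_lift (hg : Continuous g) (hp : OnePeriodic g) :
    ∃ f : C(UnitAddTorus (Fin 2), ℂ), ∀ t : Fin 2 → ℝ, f (fun i => (t i : UnitAddCircle))
      = (g (t 0, t 1) : ℂ) := by
  have hq : IsOpenQuotientMap
      (Pi.map fun _ : Fin 2 => ((↑) : ℝ → UnitAddCircle)) :=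
    IsOpenQuotientMap.piMap fun _ => QuotientAddGroup.isOpenQuotientMap_mk
  have hinv : ∀ s t : Fin 2 → ℝ, Pi.map (fun _ : Fin 2 => ((↑) : ℝ → UnitAddCircle)) s
      = Pi.map (fun _ : Fin 2 => ((↑) : ℝ → UnitAddCircle)) t →
      (g (s 0, s 1) : ℂ) = (g (t 0, t 1) : ℂ) := by
    intro s t h
    have hi : ∀ i, ∃ n : ℤ, t i + n = s i := fun i => by
      have : ((s i : ℝ) : UnitAddCircle) = (t i : ℝ) := congrFun h i
      rw [QuotientAddGroup.eq_iff_sub_mem, AddSubgroup.mem_zmultiples_iff] at this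
      obtain ⟨n, hn⟩ := this
      exact ⟨n, by rw [zsmul_eq_mul, mul_one] at hn; linarith⟩
    obtain ⟨m, hm⟩ := hi 0
    obtain ⟨n, hn⟩ := hi 1
    rw [← hm, ← hn, hp.add_int]
  have hgc : Continuous fun t : Fin 2 → ℝ => (g (t 0, t 1) : ℂ) := by fun_prop
  let F : C(Fin 2 → ℝ, ℂ) := ⟨fun t => (g (t 0, t 1) : ℂ), hgc⟩
  let P : C(Fin 2 → ℝ, UnitAddTorus (Fin 2)) :=
    ⟨Pi.map fun _ : Fin 2 => ((↑) : ℝ → UnitAddCircle), hq.continuous⟩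
  have hP : IsQuotientMap P := hq.isQuotientMap
  have hF : Function.FactorsThrough F P := fun s t h => hinv s t h
  exact ⟨hP.lift F hF, fun t => DFunLike.congr_fun (hP.lift_comp F hF) t⟩

/-- Matches the closed square with the half-open fundamental cell used for Fourier coefficients on
the torus; they differ by a null set. -/
theorem setIntegral_square_eq_pi {E : Type*} [NormedAddCommGroup E] [NormedSpace ℝ E]
    (F : ℝ × ℝ → E) :
    ∫ p in square, F p = ∫ t in {t : Fin 2 → ℝ | ∀ i, t i ∈ Set.Ioc (-(1 / 2) : ℝ) (-(1 / 2) + 1)},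
      F (t 0, t 1) := by
  have h1 : ∫ p in square, F p
      = ∫ p in Set.Ioc (-(1 / 2) : ℝ) (1 / 2) ×ˢ Set.Ioc (-(1 / 2) : ℝ) (1 / 2), F p := by
    refine setIntegral_congr_set ?_
    rw [Measure.volume_eq_prod]
    exact Measure.set_prod_ae_eq Ioc_ae_eq_Icc.symm Ioc_ae_eq_Icc.symm
  rw [h1, ← (volume_preserving_finTwoArrow ℝ).setIntegral_preimage_emb
    MeasurableEquiv.finTwoArrow.measurableEmbedding]
  congr 2
  ext t
  simp [MeasurableEquiv.finTwoArrow, Fin.forall_fin_two]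
  norm_num
  constructor <;> rintro ⟨⟨_, _⟩, _, _⟩ <;> refine ⟨⟨?_, ?_⟩, ?_, ?_⟩ <;> linarith

theorem mFourier_coe_eq (k : Fin 2 → ℤ) (t : Fin 2 → ℝ) :
    UnitAddTorus.mFourier k (fun i => (t i : UnitAddCircle))
      = (wave 0 k (t 0, t 1) : ℂ) - (wave (π / 2) k (t 0, t 1) : ℂ) * Complex.I := by
  simp only [UnitAddTorus.mFourier, ContinuousMap.coe_mk, fourier_coe_apply, Fin.prod_univ_two]
  rw [← Complex.exp_add]
  have : 2 * (π : ℂ) * Complex.I * (k 0 : ℂ) * (t 0 : ℂ) / ((1 : ℝ) : ℂ)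
      + 2 * (π : ℂ) * Complex.I * (k 1 : ℂ) * (t 1 : ℂ) / ((1 : ℝ) : ℂ)
      = ((phase k (t 0, t 1) : ℝ) : ℂ) * Complex.I := by
    rw [phase_apply]
    push_cast
    ring
  rw [this, Complex.exp_mul_I]
  simp [wave, cos_add_pi_div_two]

/-- Real Fourier expansion of a smooth periodic function on the plane. -/
theorem exists_trigSeries_eq (hg : ContDiff ℝ ∞ g) (hp : OnePeriodic g) :
    ∃ A B : (Fin 2 → ℤ) → ℝ, RapidDecay A ∧ RapidDecay B ∧
      g = fun p => trigSeries 0 A p + trigSeries (π / 2) B p := by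
  set A : (Fin 2 → ℤ) → ℝ := fun k => ∫ p in square, g p * wave 0 k p with hAdef
  set B : (Fin 2 → ℤ) → ℝ := fun k => ∫ p in square, g p * wave (π / 2) k p with hBdef
  have hA : RapidDecay A := rapidDecay_integral_mul_wave hg hp 0
  have hB : RapidDecay B := rapidDecay_integral_mul_wave hg hp (π / 2)
  obtain ⟨f, hf⟩ := exists_torus_lift hg.continuous hp
  have hwc : ∀ τ k, Continuous fun p => ((g p * wave τ k p : ℝ) : ℂ) := fun τ k =>
    Complex.continuous_ofReal.comp (hg.mul (contDiff_wave τ k)).continuous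
  -- The sign of `B` comes from `cos (θ + π/2) = -sin θ`, which makes the conjugate exponential
  -- equal to `wave 0 k + i wave (π/2) k`.
  have hcoeff : ∀ k, UnitAddTorus.mFourierCoeff f k = (A k : ℂ) + (B k : ℂ) * Complex.I := by
    intro k
    rw [UnitAddTorus.mFourierCoeff_eq_integral f k fun _ => -(1 / 2)]
    have e : ∀ t : Fin 2 → ℝ, UnitAddTorus.mFourier (-k) (fun i => (t i : UnitAddCircle)) •
        f (fun i => (t i : UnitAddCircle))
        = (fun p : ℝ × ℝ => ((g p * wave 0 k p : ℝ) : ℂ)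
          + ((g p * wave (π / 2) k p : ℝ) : ℂ) * Complex.I) (t 0, t 1) := by
      intro t
      rw [UnitAddTorus.mFourier_neg, mFourier_coe_eq, hf]
      simp only [map_sub, map_mul, Complex.conj_ofReal, Complex.conj_I, smul_eq_mul]
      push_cast
      ring
    simp only [e]
    rw [← setIntegral_square_eq_pi (fun p : ℝ × ℝ => ((g p * wave 0 k p : ℝ) : ℂ)
          + ((g p * wave (π / 2) k p : ℝ) : ℂ) * Complex.I),
      integral_add, integral_mul_const, integral_complex_ofReal, integral_complex_ofReal]
    · exact (hwc 0 k).continuousOn.integrableOn_compact isCompact_square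
    · exact ((hwc _ k).mul continuous_const).continuousOn.integrableOn_compact isCompact_square
  have hsum : Summable (UnitAddTorus.mFourierCoeff f) := by
    refine Summable.of_norm_bounded (hA.summable.add hB.summable) fun k => ?_
    rw [hcoeff]
    refine (norm_add_le _ _).trans ?_
    simp
  refine ⟨A, B, hA, hB, funext fun p => ?_⟩
  have h := UnitAddTorus.hasSum_mFourier_series_apply_of_summable hsum
    (fun i => ((![p.1, p.2] i : ℝ) : UnitAddCircle))
  rw [hf] at h
  have h2 := Complex.hasSum_re h
  have e : ∀ k, (UnitAddTorus.mFourierCoeff f k • UnitAddTorus.mFourier k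
      (fun i => ((![p.1, p.2] i : ℝ) : UnitAddCircle))).re
      = A k * wave 0 k p + B k * wave (π / 2) k p := by
    intro k
    rw [hcoeff, mFourier_coe_eq]
    simp
  simp only [e] at h2
  rw [trigSeries, trigSeries, ← Summable.tsum_add, h2.tsum_eq]
  · simp
  · exact Summable.of_norm_bounded hA.summable fun k => norm_mul_wave_le _ _ _
  · exact Summable.of_norm_bounded hB.summable fun k => norm_mul_wave_le _ _ _

theorem RapidDecay.symmetrize {A : (Fin 2 → ℤ) → ℝ} (hA : RapidDecay A) :
    RapidDecay fun k => (1 / 2) * (A k + A (reflectFreq k)) := by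
  intro N
  obtain ⟨C, hC⟩ := hA N
  obtain ⟨C', hC'⟩ := hA.comp_reflectFreq N
  refine ⟨C + C', fun k => ?_⟩
  have h1 := hC k
  have h2 := hC' k
  have h3 := abs_add_le (A k) (A (reflectFreq k))
  have hk : 0 ≤ (1 + freqSq k) ^ N := by have := freqSq_nonneg k; positivity
  have h4 := mul_le_mul_of_nonneg_right h3 hk
  have h5 := mul_nonneg (abs_nonneg (A k)) hk
  have h6 := mul_nonneg (abs_nonneg (A (reflectFreq k))) hk
  rw [abs_mul, abs_of_nonneg (by norm_num : (0 : ℝ) ≤ 1 / 2)]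
  simp only [Function.comp_apply] at h2
  nlinarith

theorem trigSeries_symmetrize {A : (Fin 2 → ℤ) → ℝ} (hA : RapidDecay A) (τ : ℝ) (p : ℝ × ℝ) :
    trigSeries τ (fun k => (1 / 2) * (A k + A (reflectFreq k))) p
      = (1 / 2) * (trigSeries τ A p + trigSeries τ A (-p.1, p.2)) := by
  rw [trigSeries_neg_fst]
  unfold trigSeries
  rw [← Summable.tsum_add, ← tsum_mul_left]
  · congr 1
    funext k
    simp only [Function.comp_apply]
    ring
  · exact Summable.of_norm_bounded hA.summable fun k => norm_mul_wave_le _ _ _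
  · exact Summable.of_norm_bounded hA.comp_reflectFreq.summable fun k => norm_mul_wave_le _ _ _

theorem evenX_trigSeries {A : (Fin 2 → ℤ) → ℝ} (h : ∀ k, A (reflectFreq k) = A k) (τ : ℝ) :
    EvenX (trigSeries τ A) := fun x y => by
  rw [trigSeries_neg_fst]
  congr 1
  exact funext h

theorem lap_add {u v : ℝ × ℝ → ℝ} (hu : ContDiff ℝ ∞ u) (hv : ContDiff ℝ ∞ v) :
    lap (fun p => u p + v p) = fun p => lap u p + lap v p := by
  have h1 : ∀ {u v : ℝ × ℝ → ℝ}, ContDiff ℝ ∞ u → ContDiff ℝ ∞ v →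
      dx (fun p => u p + v p) = fun p => dx u p + dx v p := fun hu hv => funext fun p => by
    rw [dx_eq_fderiv hu, dx_eq_fderiv hv]
    exact ((hasDerivAt_dx hu p).add (hasDerivAt_dx hv p)).deriv
  have h2 : ∀ {u v : ℝ × ℝ → ℝ}, ContDiff ℝ ∞ u → ContDiff ℝ ∞ v →
      dy (fun p => u p + v p) = fun p => dy u p + dy v p := fun hu hv => funext fun p => by
    rw [dy_eq_fderiv hu, dy_eq_fderiv hv]
    exact ((hasDerivAt_dy hu p).add (hasDerivAt_dy hv p)).deriv
  funext p
  unfold lap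
  rw [h1 hu hv, h1 (contDiff_dx hu) (contDiff_dx hv), h2 hu hv,
    h2 (contDiff_dy hu) (contDiff_dy hv)]
  ring

theorem dy_dy_add {u v : ℝ × ℝ → ℝ} (hu : ContDiff ℝ ∞ u) (hv : ContDiff ℝ ∞ v) :
    dy (dy (fun p => u p + v p)) = fun p => dy (dy u) p + dy (dy v) p := by
  have h2 : ∀ {u v : ℝ × ℝ → ℝ}, ContDiff ℝ ∞ u → ContDiff ℝ ∞ v →
      dy (fun p => u p + v p) = fun p => dy u p + dy v p := fun hu hv => funext fun p => by
    rw [dy_eq_fderiv hu, dy_eq_fderiv hv]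
    exact ((hasDerivAt_dy hu p).add (hasDerivAt_dy hv p)).deriv
  rw [h2 hu hv, h2 (contDiff_dy hu) (contDiff_dy hv)]

/-- Solvability of `Δ²φ = g_yy` on the torus, with the `L²` estimate for `Δφ`. -/
theorem exists_biharmonic_solution (hg : ContDiff ℝ ∞ g) (hp : OnePeriodic g) (he : EvenX g) :
    ∃ φ : ℝ × ℝ → ℝ, ContDiff ℝ ∞ φ ∧ OnePeriodic φ ∧ EvenX φ ∧ lap (lap φ) = dy (dy g) ∧
      ∫ p in square, lap φ p ^ 2 ≤ ∫ p in square, g p ^ 2 := by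
  obtain ⟨A, B, hA, hB, hAB⟩ := exists_trigSeries_eq hg hp
  -- Averaging the expansion of `g` with its reflection makes the coefficients visibly invariant
  -- under `reflectFreq`. This passes to the coefficients of `φ` and makes it even.
  have hg' : g = fun p => trigSeries 0 (fun k => (1 / 2) * (A k + A (reflectFreq k))) p
      + trigSeries (π / 2) (fun k => (1 / 2) * (B k + B (reflectFreq k))) p := by
    funext p
    have e1 : g (-p.1, p.2) = g p := he p.1 p.2
    have e2 := congrFun hAB p
    have e3 := congrFun hAB (-p.1, p.2)
    rw [trigSeries_symmetrize hA, trigSeries_symmetrize hB]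
    linarith
  obtain ⟨hA1, hA2⟩ := lap_lap_trigSeries_eq hA.symmetrize 0
  obtain ⟨hB1, hB2⟩ := lap_lap_trigSeries_eq hB.symmetrize (π / 2)
  have hrr : ∀ k, reflectFreq (reflectFreq k) = k := reflectFreq.left_inv
  have hr1 : ∀ k, reflectFreq k 1 = k 1 := fun k => by simp [reflectFreq]
  set a := trigSeries 0 fun k => -((2 * π * k 1) ^ 2 * ((1 / 2) * (A k + A (reflectFreq k))))
    / (4 * π ^ 2 * freqSq k) ^ 2 with ha
  set b := trigSeries (π / 2) fun k => -((2 * π * k 1) ^ 2 * ((1 / 2) * (B k + B (reflectFreq k))))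
    / (4 * π ^ 2 * freqSq k) ^ 2 with hb
  have ca : ContDiff ℝ ∞ a := contDiff_trigSeries hA1 _
  have cb : ContDiff ℝ ∞ b := contDiff_trigSeries hB1 _
  have pa : OnePeriodic a := onePeriodic_trigSeries _ _
  have pb : OnePeriodic b := onePeriodic_trigSeries _ _
  have ea : EvenX a := evenX_trigSeries (fun k => by
    simp only [hrr, hr1, freqSq_reflectFreq, add_comm]) _
  have eb : EvenX b := evenX_trigSeries (fun k => by
    simp only [hrr, hr1, freqSq_reflectFreq, add_comm]) _
  have cab : ContDiff ℝ ∞ fun p => a p + b p := ca.add cb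
  have pab : OnePeriodic fun p => a p + b p := fun x y => by
    simp [(pa x y).1, (pb x y).1, (pa x y).2, (pb x y).2]
  have heq : lap (lap fun p => a p + b p) = dy (dy g) := by
    rw [lap_add ca cb, lap_add (contDiff_lap ca) (contDiff_lap cb), hA2, hB2, hg',
      dy_dy_add (contDiff_trigSeries hA.symmetrize _) (contDiff_trigSeries hB.symmetrize _)]
  exact ⟨_, cab, pab, fun x y => by simp [ea x y, eb x y], heq,
    integral_lap_sq_le_of_biharmonic cab hg pab hp heq⟩

end FourierExpansion

/-! ### Primitives of smooth periodic functions -/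

section Primitives

variable {f : ℝ → ℝ}

theorem hasDerivAt_primitive (hf : Continuous f) (a s : ℝ) :
    HasDerivAt (fun s => ∫ u in a..s, f u) (f s) s :=
  intervalIntegral.integral_hasDerivAt_right (hf.intervalIntegrable _ _)
    hf.aestronglyMeasurable.stronglyMeasurableAtFilter hf.continuousAt

theorem contDiff_primitive (hf : ContDiff ℝ ∞ f) (a : ℝ) :
    ContDiff ℝ ∞ fun s => ∫ u in a..s, f u := by
  rw [contDiff_infty_iff_deriv]
  refine ⟨fun s => (hasDerivAt_primitive hf.continuous a s).differentiableAt, ?_⟩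
  rwa [show deriv (fun s => ∫ u in a..s, f u) = f from
    funext fun s => (hasDerivAt_primitive hf.continuous a s).deriv]

theorem integral_period_eq (hp : Function.Periodic f 1) (a : ℝ) :
    ∫ u in a..a + 1, f u = ∫ u in (0 : ℝ)..1, f u := by
  simpa using hp.intervalIntegral_add_eq a 0

theorem primitive_add_one (hf : Continuous f) (hp : Function.Periodic f 1) (a s : ℝ) :
    ∫ u in a..s + 1, f u = (∫ u in a..s, f u) + ∫ u in (0 : ℝ)..1, f u := by
  rw [← integral_period_eq hp s, intervalIntegral.integral_add_adjacent_intervals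
    (hf.intervalIntegrable _ _) (hf.intervalIntegrable _ _)]

theorem integral_period_eq_zero_of_odd (hp : Function.Periodic f 1) (ho : ∀ s, f (-s) = -f s) :
    ∫ u in (0 : ℝ)..1, f u = 0 := by
  have h1 := integral_period_eq hp (-(1 / 2))
  have h2 := intervalIntegral.integral_comp_neg (a := -(1 / 2)) (b := 1 / 2) f
  simp only [ho, intervalIntegral.integral_neg] at h2
  norm_num at h1 h2
  linarith

theorem primitive_eq_of_vanish {a s t : ℝ} (hf : Continuous f)
    (h : ∀ u ∈ Set.uIcc s t, f u = 0) : ∫ u in a..t, f u = ∫ u in a..s, f u := by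
  have : ∫ u in s..t, f u = 0 :=
    (intervalIntegral.integral_congr h).trans intervalIntegral.integral_zero
  rw [← intervalIntegral.integral_add_adjacent_intervals (hf.intervalIntegrable a s)
    (hf.intervalIntegrable s t), this, add_zero]

end Primitives

/-! ### The one-dimensional profile of a smoothed crease -/

section CreaseProfile

/-- `q` is an even `1`-periodic bump of mass `1/2` concentrated within distance `d` of the
integers, with height at most `K / d`. -/
structure IsCreaseProfile (K d : ℝ) (q : ℝ → ℝ) : Prop where
  contDiff : ContDiff ℝ ∞ q
  periodic : Function.Periodic q 1
  even : ∀ s, q (-s) = q s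
  nonneg : ∀ s, 0 ≤ q s
  le : ∀ s, q s ≤ K / d
  integral : ∫ s in (0 : ℝ)..1, q s = 1 / 2
  vanish : ∀ s, d ≤ s → s ≤ 1 - d → q s = 0

theorem exists_isCreaseProfile :
    ∃ K : ℝ, 0 < K ∧ ∀ d : ℝ, 0 < d → d ≤ 1 / 8 → ∃ q, IsCreaseProfile K d q := by
  have hm : (0 : ℝ) < expNegInvGlue (3 / 4) := expNegInvGlue.pos_of_pos (by norm_num)
  have hM : (0 : ℝ) < expNegInvGlue 1 := expNegInvGlue.pos_of_pos (by norm_num)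
  refine ⟨4 * expNegInvGlue 1 / expNegInvGlue (3 / 4), by positivity, fun d hd hd8 => ?_⟩
  -- Squaring the sine makes the bump even and 1-periodic; it vanishes as soon as `|sin πs| ≥ d`.
  set η : ℝ → ℝ := fun s => expNegInvGlue (1 - (Real.sin (Real.pi * s) / d) ^ 2) with hη
  have hsm : ContDiff ℝ ∞ η := expNegInvGlue.contDiff.comp
    (contDiff_const.sub (((Real.contDiff_sin.comp
      (contDiff_const.mul contDiff_id)).div_const d).pow 2))
  have hper : Function.Periodic η 1 := fun s => by
    simp only [hη, mul_add, mul_one, Real.sin_add_pi, neg_div, neg_sq]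
  have heven : ∀ s, η (-s) = η s := fun s => by
    simp only [hη, mul_neg, Real.sin_neg, neg_div, neg_sq]
  have h0 : ∀ s, 0 ≤ η s := fun s => expNegInvGlue.nonneg _
  have h1 : ∀ s, η s ≤ expNegInvGlue 1 := fun s =>
    expNegInvGlue.monotone (by linarith [sq_nonneg (Real.sin (Real.pi * s) / d)])
  have hsin : ∀ s, d ≤ s → s ≤ 1 - d → d ≤ Real.sin (Real.pi * s) := fun s hs hs' => by
    have key : ∀ t, 0 ≤ t → t ≤ 1 / 2 → 2 * t ≤ Real.sin (Real.pi * t) := fun t ht ht' => by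
      have := Real.mul_le_sin (x := Real.pi * t) (by positivity)
        (by nlinarith [Real.pi_pos])
      have e : 2 / Real.pi * (Real.pi * t) = 2 * t := by
        field_simp
      rwa [e] at this
    rcases le_total s (1 / 2) with h | h
    · linarith [key s (by linarith) h]
    · have := key (1 - s) (by linarith) (by linarith)
      rw [show Real.pi * (1 - s) = Real.pi - Real.pi * s by ring, Real.sin_pi_sub] at this
      linarith
  -- On `[0, d/8]` one has `sin πs ≤ 4s ≤ d/2`, so the argument of the bump is at least `3/4`. This
  -- lower bound on the mass keeps the normalized height of order `1/d`.
  have hI : expNegInvGlue (3 / 4) * (d / 8) ≤ ∫ s in (0 : ℝ)..1, η s := by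
    have i1 : ∫ _ in (0 : ℝ)..d / 8, expNegInvGlue (3 / 4) ≤ ∫ s in (0 : ℝ)..d / 8, η s := by
      refine intervalIntegral.integral_mono_on (by positivity)
        (continuous_const.intervalIntegrable _ _) (hsm.continuous.intervalIntegrable _ _)
        fun s hs => expNegInvGlue.monotone ?_
      have hs0 : 0 ≤ Real.pi * s := mul_nonneg Real.pi_pos.le hs.1
      have a1 : Real.sin (Real.pi * s) ≤ d / 2 := by
        have := Real.sin_le hs0
        nlinarith [Real.pi_lt_four, hs.1, hs.2]
      have a2 : 0 ≤ Real.sin (Real.pi * s) :=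
        Real.sin_nonneg_of_nonneg_of_le_pi hs0 (by nlinarith [Real.pi_pos, hs.2])
      have a3 : Real.sin (Real.pi * s) / d ≤ 1 / 2 := by
        rw [div_le_iff₀ hd]; linarith
      have a4 : 0 ≤ Real.sin (Real.pi * s) / d := by positivity
      nlinarith
    have i2 : ∫ s in (0 : ℝ)..d / 8, η s ≤ ∫ s in (0 : ℝ)..1, η s := by
      refine intervalIntegral.integral_mono_interval le_rfl (by positivity) (by linarith)
        (ae_of_all _ h0) (hsm.continuous.intervalIntegrable _ _)
    rw [intervalIntegral.integral_const, smul_eq_mul] at i1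
    linarith
  set I := ∫ s in (0 : ℝ)..1, η s with hIdef
  have hIpos : 0 < I := lt_of_lt_of_le (by positivity) hI
  refine ⟨fun s => η s / (2 * I), hsm.div_const _, fun s => by simp only [hper s],
    fun s => by simp only [heven s], fun s => div_nonneg (h0 s) (by positivity), fun s => ?_, ?_,
    fun s hs hs' => ?_⟩
  · calc η s / (2 * I) ≤ expNegInvGlue 1 / (2 * (expNegInvGlue (3 / 4) * (d / 8))) := by
          gcongr
          exact h1 s
      _ = 4 * expNegInvGlue 1 / expNegInvGlue (3 / 4) / d := by field_simp; norm_num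
  · rw [intervalIntegral.integral_div, ← hIdef]
    field_simp
  · have : 1 ≤ Real.sin (Real.pi * s) / d := by
      rw [le_div_iff₀ hd, one_mul]; exact hsin s hs hs'
    rw [show η s = 0 from expNegInvGlue.zero_of_nonpos (by nlinarith), zero_div]

/-- The slope profile across a crease, the primitive of the bump `q`. -/
noncomputable def creaseSlope (q : ℝ → ℝ) (s : ℝ) : ℝ := ∫ u in (0 : ℝ)..s, q u

/-- The periodic profile with second derivative `q - 1/2`. -/
noncomputable def creaseHeight (q : ℝ → ℝ) (s : ℝ) : ℝ :=
  ∫ u in (0 : ℝ)..s, (creaseSlope q u - u / 2)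

/-- The density of the Gaussian curvature near a crease. -/
noncomputable def creaseCurv (q : ℝ → ℝ) (s : ℝ) : ℝ :=
  q s * (creaseSlope q s - creaseSlope q (s - 1 / 2) - 1 / 4)

/-- The primitive of `creaseCurv` which vanishes away from the creases. -/
noncomputable def creaseCurvInt (q : ℝ → ℝ) (s : ℝ) : ℝ := ∫ u in (1 / 2 : ℝ)..s, creaseCurv q u

/-- The mean value of `creaseCurvInt`. -/
noncomputable def creaseMean (q : ℝ → ℝ) : ℝ := ∫ u in (0 : ℝ)..1, creaseCurvInt q u

/-- A periodic second primitive of `creaseCurv`. -/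
noncomputable def creasePotential (q : ℝ → ℝ) (s : ℝ) : ℝ :=
  ∫ u in (0 : ℝ)..s, (creaseCurvInt q u - creaseMean q)

namespace IsCreaseProfile

variable {K d : ℝ} {q : ℝ → ℝ}

theorem vanish_of_mem (hq : IsCreaseProfile K d q) {s : ℝ} {n : ℤ}
    (h : |s - (n + 1 / 2)| ≤ 1 / 2 - d) : q s = 0 := by
  rw [abs_le] at h
  have := hq.periodic.sub_int_mul_eq (x := s) n
  rw [mul_one] at this
  rw [← this]
  exact hq.vanish _ (by linarith) (by linarith)

theorem exists_near_of_ne_zero (hq : IsCreaseProfile K d q) {s : ℝ} (h : q s ≠ 0) :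
    ∃ n : ℤ, |s - n| < d := by
  by_contra! hc
  have hr := abs_sub_round s
  have h1 := hc (round s)
  apply h
  rw [le_abs] at h1
  rw [abs_le] at hr
  rcases h1 with h1 | h1
  · refine hq.vanish_of_mem (n := round s) (abs_le.2 ⟨?_, ?_⟩) <;> linarith
  · refine hq.vanish_of_mem (n := round s - 1) (abs_le.2 ⟨?_, ?_⟩) <;> push_cast <;> linarith

theorem hasDerivAt_slope (hq : IsCreaseProfile K d q) (s : ℝ) :
    HasDerivAt (creaseSlope q) (q s) s := hasDerivAt_primitive hq.contDiff.continuous 0 s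

theorem contDiff_slope (hq : IsCreaseProfile K d q) : ContDiff ℝ ∞ (creaseSlope q) :=
  contDiff_primitive hq.contDiff 0

theorem slope_add_one (hq : IsCreaseProfile K d q) (s : ℝ) :
    creaseSlope q (s + 1) = creaseSlope q s + 1 / 2 := by
  rw [creaseSlope, primitive_add_one hq.contDiff.continuous hq.periodic, hq.integral, creaseSlope]

theorem slope_neg (hq : IsCreaseProfile K d q) (s : ℝ) :
    creaseSlope q (-s) = -creaseSlope q s := by
  have := intervalIntegral.integral_comp_neg (a := 0) (b := s) q
  simp only [hq.even, neg_zero] at this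
  rw [creaseSlope, creaseSlope, this, ← intervalIntegral.integral_symm]

theorem monotone_slope (hq : IsCreaseProfile K d q) : Monotone (creaseSlope q) :=
  monotone_of_hasDerivAt_nonneg hq.hasDerivAt_slope hq.nonneg

theorem slope_half (hq : IsCreaseProfile K d q) : creaseSlope q (1 / 2) = 1 / 4 := by
  have h1 := hq.slope_add_one (-(1 / 2))
  rw [hq.slope_neg] at h1
  norm_num at h1 ⊢
  linarith

theorem slope_add_int (hq : IsCreaseProfile K d q) (s : ℝ) (n : ℤ) :
    creaseSlope q (s + n) = creaseSlope q s + n / 2 := by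
  have hp : Function.Periodic (fun s => creaseSlope q s - s / 2) 1 := fun s => by
    simp only [hq.slope_add_one]; ring
  have := hp.int_mul n s
  simp only [mul_one] at this
  linarith

/-- Between creases the slope is constant; oddness and the jump of `1/2` per period fix its value at
`1/2`. -/
theorem slope_plateau (hq : IsCreaseProfile K d q) {s : ℝ} {n : ℤ}
    (h : |s - (n + 1 / 2)| ≤ 1 / 2 - d) : creaseSlope q s = n / 2 + 1 / 4 := by
  have e : creaseSlope q (s - n) = creaseSlope q (1 / 2) := by
    refine primitive_eq_of_vanish hq.contDiff.continuous fun u hu => ?_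
    rw [abs_le] at h
    rw [Set.mem_uIcc] at hu
    rcases hu with hu | hu <;> exact hq.vanish u (by linarith) (by linarith)
  have := hq.slope_add_int (s - n) n
  rw [sub_add_cancel, e, hq.slope_half] at this
  linarith

theorem contDiff_height (hq : IsCreaseProfile K d q) : ContDiff ℝ ∞ (creaseHeight q) :=
  contDiff_primitive (hq.contDiff_slope.sub (contDiff_id.div_const 2)) 0

theorem hasDerivAt_height (hq : IsCreaseProfile K d q) (s : ℝ) :
    HasDerivAt (creaseHeight q) (creaseSlope q s - s / 2) s :=
  hasDerivAt_primitive (hq.contDiff_slope.sub (contDiff_id.div_const 2)).continuous 0 s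

theorem periodic_height (hq : IsCreaseProfile K d q) : Function.Periodic (creaseHeight q) 1 := by
  intro s
  have hp : Function.Periodic (fun s => creaseSlope q s - s / 2) 1 := fun s => by
    simp only [hq.slope_add_one]; ring
  have hc : Continuous fun s => creaseSlope q s - s / 2 :=
    (hq.contDiff_slope.sub (contDiff_id.div_const 2)).continuous
  rw [creaseHeight, primitive_add_one hc hp,
    integral_period_eq_zero_of_odd hp fun s => by rw [hq.slope_neg]; ring, add_zero, creaseHeight]

theorem contDiff_curv (hq : IsCreaseProfile K d q) : ContDiff ℝ ∞ (creaseCurv q) :=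
  hq.contDiff.mul ((hq.contDiff_slope.sub
    (hq.contDiff_slope.comp (contDiff_id.sub contDiff_const))).sub contDiff_const)

theorem periodic_curv (hq : IsCreaseProfile K d q) : Function.Periodic (creaseCurv q) 1 := by
  intro s
  have e : s + 1 - 1 / 2 = s - 1 / 2 + 1 := by ring
  rw [creaseCurv, creaseCurv, e, hq.periodic, hq.slope_add_one, hq.slope_add_one]
  ring

/-- This oddness is the cancellation behind the construction: the curvature of a crease has mean
zero, so its primitives are periodic and small. -/
theorem curv_neg (hq : IsCreaseProfile K d q) (s : ℝ) : creaseCurv q (-s) = -creaseCurv q s := by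
  have e : -s - 1 / 2 = -(s - 1 / 2 + 1) := by ring
  rw [creaseCurv, creaseCurv, e, hq.even, hq.slope_neg, hq.slope_neg, hq.slope_add_one]
  ring

theorem abs_slope_sub_le (hq : IsCreaseProfile K d q) {s t : ℝ} (h1 : s ≤ t) (h2 : t ≤ s + 1) :
    |creaseSlope q t - creaseSlope q s - 1 / 4| ≤ 1 / 4 := by
  have a := hq.monotone_slope h1
  have b := hq.monotone_slope h2
  rw [hq.slope_add_one] at b
  rw [abs_le]
  constructor <;> linarith

theorem abs_curv_le (hq : IsCreaseProfile K d q) (s : ℝ) : |creaseCurv q s| ≤ q s / 4 := by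
  rw [creaseCurv, abs_mul, abs_of_nonneg (hq.nonneg s)]
  have := mul_le_mul_of_nonneg_left (hq.abs_slope_sub_le (s := s - 1 / 2) (t := s)
    (by linarith) (by linarith)) (hq.nonneg s)
  linarith

theorem integral_curv (hq : IsCreaseProfile K d q) : ∫ u in (0 : ℝ)..1, creaseCurv q u = 0 :=
  integral_period_eq_zero_of_odd hq.periodic_curv hq.curv_neg

theorem contDiff_curvInt (hq : IsCreaseProfile K d q) : ContDiff ℝ ∞ (creaseCurvInt q) :=
  contDiff_primitive hq.contDiff_curv _

theorem hasDerivAt_curvInt (hq : IsCreaseProfile K d q) (s : ℝ) :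
    HasDerivAt (creaseCurvInt q) (creaseCurv q s) s :=
  hasDerivAt_primitive hq.contDiff_curv.continuous _ s

theorem periodic_curvInt (hq : IsCreaseProfile K d q) :
    Function.Periodic (creaseCurvInt q) 1 := by
  intro s
  rw [creaseCurvInt, primitive_add_one hq.contDiff_curv.continuous hq.periodic_curv,
    hq.integral_curv, add_zero, creaseCurvInt]

theorem curvInt_plateau (hq : IsCreaseProfile K d q) {s : ℝ} {n : ℤ}
    (h : |s - (n + 1 / 2)| ≤ 1 / 2 - d) : creaseCurvInt q s = 0 := by
  have := hq.periodic_curvInt.sub_int_mul_eq (x := s) n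
  rw [mul_one] at this
  rw [← this, creaseCurvInt]
  refine (primitive_eq_of_vanish (s := 1 / 2) hq.contDiff_curv.continuous fun u hu => ?_).trans
    intervalIntegral.integral_same
  rw [abs_le] at h
  rw [Set.mem_uIcc] at hu
  rw [creaseCurv, hq.vanish u, zero_mul] <;> rcases hu with hu | hu <;> linarith

/-- The curvature is dominated by `q / 4` and `q` has mass `1/2` per period. -/
theorem abs_curvInt_le (hq : IsCreaseProfile K d q) (s : ℝ) : |creaseCurvInt q s| ≤ 1 / 8 := by
  obtain ⟨t, ht, hst⟩ := hq.periodic_curvInt.exists_mem_Ico one_pos s (1 / 2)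
  rw [hst]
  have hc := hq.contDiff_curv.continuous
  calc |creaseCurvInt q t| ≤ ∫ u in (1 / 2 : ℝ)..t, |creaseCurv q u| :=
        intervalIntegral.abs_integral_le_integral_abs ht.1
    _ ≤ ∫ u in (1 / 2 : ℝ)..t, q u / 4 :=
        intervalIntegral.integral_mono_on ht.1 (hc.abs.intervalIntegrable _ _)
          ((hq.contDiff.continuous.div_const _).intervalIntegrable _ _)
          fun u _ => hq.abs_curv_le u
    _ ≤ ∫ u in (1 / 2 : ℝ)..1 / 2 + 1, q u / 4 :=
        intervalIntegral.integral_mono_interval le_rfl ht.1 ht.2.le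
          (ae_of_all _ fun u => div_nonneg (hq.nonneg u) (by norm_num))
          ((hq.contDiff.continuous.div_const _).intervalIntegrable _ _)
    _ = 1 / 8 := by
        rw [intervalIntegral.integral_div, integral_period_eq hq.periodic, hq.integral]
        norm_num

theorem integral_abs_curvInt_le (hq : IsCreaseProfile K d q) (hd : 0 < d) (hd8 : d ≤ 1 / 8) :
    ∫ u in (0 : ℝ)..1, |creaseCurvInt q u| ≤ d / 4 := by
  have hp : Function.Periodic (fun u => |creaseCurvInt q u|) 1 := fun u => by
    simp only [hq.periodic_curvInt u]
  have hc := hq.contDiff_curvInt.continuous.abs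
  have hi : ∀ a b, IntervalIntegrable (fun u => |creaseCurvInt q u|) volume a b := fun a b =>
    hc.intervalIntegrable a b
  have h0 : ∫ u in d..1 - d, |creaseCurvInt q u| = 0 := by
    refine (intervalIntegral.integral_congr fun u hu => ?_).trans intervalIntegral.integral_zero
    rw [Set.uIcc_of_le (by linarith)] at hu
    have : creaseCurvInt q u = 0 := hq.curvInt_plateau (n := 0) (abs_le.2
      ⟨by push_cast; linarith [hu.1], by push_cast; linarith [hu.2]⟩)
    simp [this]
  have h1 : ∫ u in (1 - d)..(1 + d), |creaseCurvInt q u| ≤ ∫ _ in (1 - d)..(1 + d), (1 / 8 : ℝ) :=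
    intervalIntegral.integral_mono_on (by linarith) (hi _ _)
      (continuous_const.intervalIntegrable _ _) fun u _ => hq.abs_curvInt_le u
  rw [intervalIntegral.integral_const, smul_eq_mul] at h1
  -- The period is shifted to `[d, 1 + d]`, where the support is a single interval of length `2d`.
  have h2 := integral_period_eq hp d
  rw [← h2, add_comm d 1, ← intervalIntegral.integral_add_adjacent_intervals (hi d (1 - d))
    (hi (1 - d) (1 + d)), h0]
  linarith

theorem abs_mean_le (hq : IsCreaseProfile K d q) (hd : 0 < d) (hd8 : d ≤ 1 / 8) :
    |creaseMean q| ≤ d / 4 :=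
  (intervalIntegral.abs_integral_le_integral_abs zero_le_one).trans
    (hq.integral_abs_curvInt_le hd hd8)

theorem contDiff_potential (hq : IsCreaseProfile K d q) : ContDiff ℝ ∞ (creasePotential q) :=
  contDiff_primitive (hq.contDiff_curvInt.sub contDiff_const) 0

theorem hasDerivAt_potential (hq : IsCreaseProfile K d q) (s : ℝ) :
    HasDerivAt (creasePotential q) (creaseCurvInt q s - creaseMean q) s :=
  hasDerivAt_primitive (hq.contDiff_curvInt.sub contDiff_const).continuous 0 s

theorem periodic_potential (hq : IsCreaseProfile K d q) :
    Function.Periodic (creasePotential q) 1 := by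
  intro s
  have hp : Function.Periodic (fun u => creaseCurvInt q u - creaseMean q) 1 := fun u => by
    simp only [hq.periodic_curvInt u]
  have hz : ∫ u in (0 : ℝ)..1, (creaseCurvInt q u - creaseMean q) = 0 := by
    rw [intervalIntegral.integral_sub (hq.contDiff_curvInt.continuous.intervalIntegrable _ _)
      (continuous_const.intervalIntegrable _ _), intervalIntegral.integral_const]
    simp [creaseMean]
  rw [creasePotential, primitive_add_one (hq.contDiff_curvInt.sub contDiff_const).continuous hp,
    hz, add_zero, creasePotential]

theorem abs_potential_le (hq : IsCreaseProfile K d q) (hd : 0 < d) (hd8 : d ≤ 1 / 8) (s : ℝ) :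
    |creasePotential q s| ≤ d / 2 := by
  obtain ⟨t, ht, hst⟩ := hq.periodic_potential.exists_mem_Ico₀ one_pos s
  rw [hst]
  have hc := (hq.contDiff_curvInt.sub (contDiff_const (c := creaseMean q))).continuous
  have hA := hq.contDiff_curvInt.continuous
  calc |creasePotential q t| ≤ ∫ u in (0 : ℝ)..t, |creaseCurvInt q u - creaseMean q| :=
        intervalIntegral.abs_integral_le_integral_abs ht.1
    _ ≤ ∫ u in (0 : ℝ)..1, |creaseCurvInt q u - creaseMean q| :=
        intervalIntegral.integral_mono_interval le_rfl ht.1 ht.2.le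
          (ae_of_all _ fun u => abs_nonneg _) (hc.abs.intervalIntegrable _ _)
    _ ≤ ∫ u in (0 : ℝ)..1, (|creaseCurvInt q u| + |creaseMean q|) :=
        intervalIntegral.integral_mono_on zero_le_one (hc.abs.intervalIntegrable _ _)
          ((hA.abs.add continuous_const).intervalIntegrable _ _) fun u _ => abs_sub _ _
    _ = (∫ u in (0 : ℝ)..1, |creaseCurvInt q u|) + |creaseMean q| := by
        rw [intervalIntegral.integral_add (hA.abs.intervalIntegrable _ _)
          (continuous_const.intervalIntegrable _ _)]
        simp
    _ ≤ d / 2 := by linarith [hq.integral_abs_curvInt_le hd hd8, hq.abs_mean_le hd hd8]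

/-- On a crease of the first family, the other family does not contribute. -/
theorem interaction_first (hq : IsCreaseProfile K d q) (hd8 : d ≤ 1 / 8) {s t : ℝ}
    (h1 : 1 / 4 ≤ s - t) (h2 : s - t ≤ 3 / 4) :
    q s * q t = 0 ∧
      q s * (creaseSlope q s - creaseSlope q t - 1 / 4) = creaseCurv q s := by
  by_cases hs : q s = 0
  · simp [creaseCurv, hs]
  obtain ⟨n, hn⟩ := hq.exists_near_of_ne_zero hs
  rw [abs_lt] at hn
  -- With `s` within `d` of `n`, the offset places `t` in `[n - 3/4 - d, n - 1/4 + d]`; `d ≤ 1/8`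
  -- keeps this inside the plateau. There the slopes at `t` and at `s - 1/2` coincide, so the crease
  -- decouples.
  have ht : |t - ((n - 1 : ℤ) + 1 / 2)| ≤ 1 / 2 - d := by
    rw [abs_le]; push_cast; constructor <;> linarith
  have hs' : |s - 1 / 2 - ((n - 1 : ℤ) + 1 / 2)| ≤ 1 / 2 - d := by
    rw [abs_le]; push_cast; constructor <;> linarith
  rw [hq.vanish_of_mem ht, mul_zero, creaseCurv, hq.slope_plateau ht, hq.slope_plateau hs']
  exact ⟨rfl, rfl⟩

/-- On a crease of the second family, the other family does not contribute. -/
theorem interaction_second (hq : IsCreaseProfile K d q) (hd8 : d ≤ 1 / 8) {s t : ℝ}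
    (h1 : 1 / 4 ≤ s - t) (h2 : s - t ≤ 3 / 4) :
    q t * (creaseSlope q s - creaseSlope q t - 1 / 4) = -creaseCurv q t := by
  by_cases ht : q t = 0
  · simp [creaseCurv, ht]
  obtain ⟨n, hn⟩ := hq.exists_near_of_ne_zero ht
  rw [abs_lt] at hn
  have hs : |s - (n + 1 / 2)| ≤ 1 / 2 - d := by
    rw [abs_le]; constructor <;> linarith
  have ht' : |t - 1 / 2 - ((n - 1 : ℤ) + 1 / 2)| ≤ 1 / 2 - d := by
    rw [abs_le]; push_cast; constructor <;> linarith
  rw [creaseCurv, hq.slope_plateau hs, hq.slope_plateau ht']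
  push_cast
  ring

end IsCreaseProfile

end CreaseProfile

/-! ### The deflection with two families of curved creases, and its energies -/

section CurvedCreases

/-- The shape of the curved creases. -/
noncomputable def creaseLine (x : ℝ) : ℝ := Real.cos (2 * Real.pi * x) / 8

/-- The derivative of `creaseLine`. -/
noncomputable def creaseLine' (x : ℝ) : ℝ := -(Real.pi / 4) * Real.sin (2 * Real.pi * x)

/-- The second derivative of `creaseLine`. -/
noncomputable def creaseLine'' (x : ℝ) : ℝ := -(Real.pi ^ 2 / 2) * Real.cos (2 * Real.pi * x)

theorem hasDerivAt_creaseLine (x : ℝ) : HasDerivAt creaseLine (creaseLine' x) x := by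
  have h : HasDerivAt (fun x : ℝ => 2 * Real.pi * x) (2 * Real.pi) x := by
    simpa using (hasDerivAt_id x).const_mul (2 * Real.pi)
  refine (h.cos.div_const 8).congr_deriv ?_
  unfold creaseLine'
  ring

theorem hasDerivAt_creaseLine' (x : ℝ) : HasDerivAt creaseLine' (creaseLine'' x) x := by
  have h : HasDerivAt (fun x : ℝ => 2 * Real.pi * x) (2 * Real.pi) x := by
    simpa using (hasDerivAt_id x).const_mul (2 * Real.pi)
  refine (h.sin.const_mul (-(Real.pi / 4))).congr_deriv ?_
  unfold creaseLine''
  ring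

theorem contDiff_creaseLine : ContDiff ℝ ∞ creaseLine :=
  (Real.contDiff_cos.comp (contDiff_const.mul contDiff_id)).div_const 8

theorem contDiff_creaseLine'' : ContDiff ℝ ∞ creaseLine'' :=
  contDiff_const.mul (Real.contDiff_cos.comp (contDiff_const.mul contDiff_id))

theorem creaseLine_add_one (x : ℝ) : creaseLine (x + 1) = creaseLine x := by
  simp only [creaseLine, mul_add, mul_one, Real.cos_add_two_pi]

theorem creaseLine''_add_one (x : ℝ) : creaseLine'' (x + 1) = creaseLine'' x := by
  simp only [creaseLine'', mul_add, mul_one, Real.cos_add_two_pi]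

theorem creaseLine_neg (x : ℝ) : creaseLine (-x) = creaseLine x := by
  simp only [creaseLine, mul_neg, Real.cos_neg]

theorem creaseLine''_neg (x : ℝ) : creaseLine'' (-x) = creaseLine'' x := by
  simp only [creaseLine'', mul_neg, Real.cos_neg]

theorem abs_creaseLine_le (x : ℝ) : |creaseLine x| ≤ 1 / 8 := by
  rw [creaseLine, abs_div, abs_of_nonneg (by norm_num : (0 : ℝ) ≤ 8)]
  linarith [Real.abs_cos_le_one (2 * Real.pi * x)]

theorem creaseLine'_sq_le (x : ℝ) : creaseLine' x ^ 2 ≤ 1 := by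
  have h := Real.sin_sq_le_one (2 * Real.pi * x)
  have hp : (Real.pi / 4) ^ 2 ≤ 1 := by nlinarith [Real.pi_pos, Real.pi_lt_four]
  have := mul_le_mul hp h (sq_nonneg _) zero_le_one
  rw [creaseLine', mul_pow, neg_sq]
  linarith

theorem abs_creaseLine''_le (x : ℝ) : |creaseLine'' x| ≤ 8 := by
  have h := Real.abs_cos_le_one (2 * Real.pi * x)
  have hp : Real.pi ^ 2 / 2 ≤ 8 := by nlinarith [Real.pi_pos, Real.pi_lt_four]
  rw [creaseLine'', abs_mul, abs_neg, abs_of_nonneg (by positivity)]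
  have := mul_le_mul hp h (abs_nonneg _) (by norm_num)
  linarith

theorem integral_creaseLine'_sq :
    ∫ x in (-(1 / 2) : ℝ)..(1 / 2), creaseLine' x ^ 2 = Real.pi ^ 2 / 32 := by
  simp only [creaseLine', mul_pow, neg_sq]
  rw [intervalIntegral.integral_const_mul,
    intervalIntegral.integral_comp_mul_left (fun x => Real.sin x ^ 2) (by positivity),
    integral_sin_sq]
  have e1 : 2 * Real.pi * (1 / 2) = Real.pi := by ring
  have e2 : 2 * Real.pi * -(1 / 2) = -Real.pi := by ring
  rw [e1, e2, Real.sin_neg, Real.sin_pi, smul_eq_mul]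
  field_simp
  ring

/-- The deflection with creases along the curves `y = -creaseLine x` and
`y = 1/2 + creaseLine x`. -/
noncomputable def deflection (q : ℝ → ℝ) (p : ℝ × ℝ) : ℝ :=
  creaseHeight q (p.2 + creaseLine p.1) + creaseHeight q (p.2 - 1 / 2 - creaseLine p.1)
    + creaseLine p.1 ^ 2 / 2

/-- The factor `R` in `w_x = creaseLine' * R`. -/
noncomputable def facetSign (q : ℝ → ℝ) (p : ℝ × ℝ) : ℝ :=
  creaseSlope q (p.2 + creaseLine p.1) - creaseSlope q (p.2 - 1 / 2 - creaseLine p.1) - 1 / 4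

/-- The load `g` for which the Airy function solves `Δ²φ = g_yy`. -/
noncomputable def airyLoad (q : ℝ → ℝ) (p : ℝ × ℝ) : ℝ :=
  -(creaseLine'' p.1 * (creasePotential q (p.2 + creaseLine p.1)
    - creasePotential q (p.2 - 1 / 2 - creaseLine p.1)))

theorem contDiff_first : ContDiff ℝ ∞ fun p : ℝ × ℝ => p.2 + creaseLine p.1 :=
  contDiff_snd.add (contDiff_creaseLine.comp contDiff_fst)

theorem contDiff_second : ContDiff ℝ ∞ fun p : ℝ × ℝ => p.2 - 1 / 2 - creaseLine p.1 :=
  (contDiff_snd.sub contDiff_const).sub (contDiff_creaseLine.comp contDiff_fst)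

theorem hasDerivAt_first_fst (x y : ℝ) :
    HasDerivAt (fun s => y + creaseLine s) (creaseLine' x) x :=
  (hasDerivAt_creaseLine x).const_add y

theorem hasDerivAt_second_fst (x y : ℝ) :
    HasDerivAt (fun s => y - 1 / 2 - creaseLine s) (-creaseLine' x) x :=
  (hasDerivAt_creaseLine x).const_sub (y - 1 / 2)

theorem hasDerivAt_first_snd (x y : ℝ) : HasDerivAt (fun t => t + creaseLine x) 1 y :=
  (hasDerivAt_id y).add_const _

theorem hasDerivAt_second_snd (x y : ℝ) : HasDerivAt (fun t => t - 1 / 2 - creaseLine x) 1 y :=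
  ((hasDerivAt_id y).sub_const _).sub_const _

/-- The amplitude `1/8` of the crease line is what keeps the two families separated. -/
theorem first_sub_second_mem (x y : ℝ) :
    1 / 4 ≤ (y + creaseLine x) - (y - 1 / 2 - creaseLine x) ∧
      (y + creaseLine x) - (y - 1 / 2 - creaseLine x) ≤ 3 / 4 := by
  have := abs_le.1 (abs_creaseLine_le x)
  constructor <;> linarith

theorem integral_comp_add_const_period {f : ℝ → ℝ} (hf : Function.Periodic f 1) (a : ℝ) :
    ∫ y in (-(1 / 2) : ℝ)..(1 / 2), f (y + a) = ∫ y in (0 : ℝ)..1, f y := by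
  rw [intervalIntegral.integral_comp_add_right, ← integral_period_eq hf (-(1 / 2) + a)]
  congr 1
  ring

theorem integral_square_const (c : ℝ) : ∫ _ in square, c = c := by
  rw [integral_square continuous_const]
  simp
  norm_num

namespace IsCreaseProfile

variable {K d : ℝ} {q : ℝ → ℝ}

theorem contDiff_deflection (hq : IsCreaseProfile K d q) : ContDiff ℝ ∞ (deflection q) :=
  ((hq.contDiff_height.comp contDiff_first).add (hq.contDiff_height.comp contDiff_second)).add
    (((contDiff_creaseLine.comp contDiff_fst).pow 2).div_const 2)

theorem contDiff_airyLoad (hq : IsCreaseProfile K d q) : ContDiff ℝ ∞ (airyLoad q) :=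
  ((contDiff_creaseLine''.comp contDiff_fst).mul
    ((hq.contDiff_potential.comp contDiff_first).sub
      (hq.contDiff_potential.comp contDiff_second))).neg

theorem onePeriodic_deflection (hq : IsCreaseProfile K d q) : OnePeriodic (deflection q) := by
  refine fun x y => ⟨by simp only [deflection, creaseLine_add_one], ?_⟩
  have e1 : y + 1 + creaseLine x = y + creaseLine x + 1 := by ring
  have e2 : y + 1 - 1 / 2 - creaseLine x = y - 1 / 2 - creaseLine x + 1 := by ring
  simp only [deflection, e1, e2, hq.periodic_height _]

theorem onePeriodic_airyLoad (hq : IsCreaseProfile K d q) : OnePeriodic (airyLoad q) := by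
  refine fun x y => ⟨by simp only [airyLoad, creaseLine_add_one, creaseLine''_add_one], ?_⟩
  have e1 : y + 1 + creaseLine x = y + creaseLine x + 1 := by ring
  have e2 : y + 1 - 1 / 2 - creaseLine x = y - 1 / 2 - creaseLine x + 1 := by ring
  simp only [airyLoad, e1, e2, hq.periodic_potential _]

/-- The linear parts of the two slopes contribute `-f' (1/4 + f)`; the term `f²/2` of the deflection
contributes `f f'` and removes the dependence on `f`, leaving the facet values `±1/4`. -/
theorem dx_deflection (hq : IsCreaseProfile K d q) :
    dx (deflection q) = fun p => creaseLine' p.1 * facetSign q p := by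
  funext p
  have h1 := (hq.hasDerivAt_height (p.2 + creaseLine p.1)).comp p.1
    (hasDerivAt_first_fst p.1 p.2)
  have h2 := (hq.hasDerivAt_height (p.2 - 1 / 2 - creaseLine p.1)).comp p.1
    (hasDerivAt_second_fst p.1 p.2)
  have h3 := ((hasDerivAt_creaseLine p.1).pow 2).div_const 2
  refine ((h1.add h2).add h3).deriv.trans ?_
  simp only [facetSign]
  ring

theorem dx_dx_deflection (hq : IsCreaseProfile K d q) :
    dx (dx (deflection q)) = fun p => creaseLine'' p.1 * facetSign q p
      + creaseLine' p.1 ^ 2 * (q (p.2 + creaseLine p.1) + q (p.2 - 1 / 2 - creaseLine p.1)) := by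
  rw [hq.dx_deflection]
  funext p
  have h1 := (hq.hasDerivAt_slope (p.2 + creaseLine p.1)).comp p.1
    (hasDerivAt_first_fst p.1 p.2)
  have h2 := (hq.hasDerivAt_slope (p.2 - 1 / 2 - creaseLine p.1)).comp p.1
    (hasDerivAt_second_fst p.1 p.2)
  refine ((hasDerivAt_creaseLine' p.1).mul ((h1.sub h2).sub_const (1 / 4))).deriv.trans ?_
  simp only [facetSign, Function.comp_apply, Pi.sub_apply]
  ring

theorem hasDerivAt_facetSign_snd (hq : IsCreaseProfile K d q) (x y : ℝ) :
    HasDerivAt (fun t => facetSign q (x, t))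
      (q (y + creaseLine x) - q (y - 1 / 2 - creaseLine x)) y := by
  have h1 := (hq.hasDerivAt_slope (y + creaseLine x)).comp y (hasDerivAt_first_snd x y)
  have h2 := (hq.hasDerivAt_slope (y - 1 / 2 - creaseLine x)).comp y (hasDerivAt_second_snd x y)
  exact ((h1.sub h2).sub_const (1 / 4)).congr_deriv (by ring)

theorem dy_dx_deflection (hq : IsCreaseProfile K d q) :
    dy (dx (deflection q)) = fun p => creaseLine' p.1 *
      (q (p.2 + creaseLine p.1) - q (p.2 - 1 / 2 - creaseLine p.1)) := by
  rw [hq.dx_deflection]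
  funext p
  exact ((hq.hasDerivAt_facetSign_snd p.1 p.2).const_mul (creaseLine' p.1)).deriv

theorem dy_dy_deflection (hq : IsCreaseProfile K d q) :
    dy (dy (deflection q)) = fun p =>
      q (p.2 + creaseLine p.1) + q (p.2 - 1 / 2 - creaseLine p.1) - 1 := by
  have h0 : dy (deflection q) = fun p =>
      (creaseSlope q (p.2 + creaseLine p.1) - (p.2 + creaseLine p.1) / 2)
      + (creaseSlope q (p.2 - 1 / 2 - creaseLine p.1) - (p.2 - 1 / 2 - creaseLine p.1) / 2) := by
    funext p
    have h1 := (hq.hasDerivAt_height (p.2 + creaseLine p.1)).comp p.2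
      (hasDerivAt_first_snd p.1 p.2)
    have h2 := (hq.hasDerivAt_height (p.2 - 1 / 2 - creaseLine p.1)).comp p.2
      (hasDerivAt_second_snd p.1 p.2)
    refine ((h1.add h2).add_const (creaseLine p.1 ^ 2 / 2)).deriv.trans ?_
    ring
  rw [h0]
  funext p
  have h1 := (hq.hasDerivAt_slope (p.2 + creaseLine p.1)).comp p.2
    (hasDerivAt_first_snd p.1 p.2)
  have h2 := (hq.hasDerivAt_slope (p.2 - 1 / 2 - creaseLine p.1)).comp p.2
    (hasDerivAt_second_snd p.1 p.2)
  refine ((h1.sub ((hasDerivAt_first_snd p.1 p.2).div_const 2)).add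
    (h2.sub ((hasDerivAt_second_snd p.1 p.2).div_const 2))).deriv.trans ?_
  ring

theorem dy_dy_airyLoad (hq : IsCreaseProfile K d q) :
    dy (dy (airyLoad q)) = fun p => -(creaseLine'' p.1 * (creaseCurv q (p.2 + creaseLine p.1)
      - creaseCurv q (p.2 - 1 / 2 - creaseLine p.1))) := by
  have h0 : dy (airyLoad q) = fun p => -(creaseLine'' p.1 *
      (creaseCurvInt q (p.2 + creaseLine p.1)
        - creaseCurvInt q (p.2 - 1 / 2 - creaseLine p.1))) := by
    funext p
    have h1 := (hq.hasDerivAt_potential (p.2 + creaseLine p.1)).comp p.2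
      (hasDerivAt_first_snd p.1 p.2)
    have h2 := (hq.hasDerivAt_potential (p.2 - 1 / 2 - creaseLine p.1)).comp p.2
      (hasDerivAt_second_snd p.1 p.2)
    refine ((h1.sub h2).const_mul (creaseLine'' p.1)).neg.deriv.trans ?_
    ring
  rw [h0]
  funext p
  have h1 := (hq.hasDerivAt_curvInt (p.2 + creaseLine p.1)).comp p.2
    (hasDerivAt_first_snd p.1 p.2)
  have h2 := (hq.hasDerivAt_curvInt (p.2 - 1 / 2 - creaseLine p.1)).comp p.2
    (hasDerivAt_second_snd p.1 p.2)
  refine ((h1.sub h2).const_mul (creaseLine'' p.1)).neg.deriv.trans ?_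
  ring

theorem facetSign_mul (hq : IsCreaseProfile K d q) (hd8 : d ≤ 1 / 8) (p : ℝ × ℝ) :
    q (p.2 + creaseLine p.1) * q (p.2 - 1 / 2 - creaseLine p.1) = 0 ∧
    q (p.2 + creaseLine p.1) * facetSign q p = creaseCurv q (p.2 + creaseLine p.1) ∧
    q (p.2 - 1 / 2 - creaseLine p.1) * facetSign q p
      = -creaseCurv q (p.2 - 1 / 2 - creaseLine p.1) := by
  obtain ⟨h1, h2⟩ := first_sub_second_mem p.1 p.2
  obtain ⟨a, b⟩ := hq.interaction_first hd8 h1 h2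
  exact ⟨a, b, hq.interaction_second hd8 h1 h2⟩

/-- The terms in `f'²` cancel except for `4 f'² q(a) q(b)`, which vanishes by disjointness of the
creases. What remains is `f'' R (q(a) + q(b))`, a sum of isolated crease curvatures. -/
theorem bracket_deflection_add (hq : IsCreaseProfile K d q) (hd8 : d ≤ 1 / 8) (p : ℝ × ℝ) :
    bracket (deflection q) (deflection q) p + dx (dx (deflection q)) p
      = -dy (dy (airyLoad q)) p := by
  obtain ⟨h1, h2, h3⟩ := hq.facetSign_mul hd8 p
  rw [bracket, hq.dy_dx_deflection, hq.dx_dx_deflection, hq.dy_dy_deflection, hq.dy_dy_airyLoad]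
  simp only
  linear_combination creaseLine'' p.1 * h2 + creaseLine'' p.1 * h3
    + 4 * creaseLine' p.1 ^ 2 * h1

theorem abs_facetSign_le (hq : IsCreaseProfile K d q) (p : ℝ × ℝ) : |facetSign q p| ≤ 1 / 4 := by
  obtain ⟨h1, h2⟩ := first_sub_second_mem p.1 p.2
  exact hq.abs_slope_sub_le (by linarith) (by linarith)

/-- In `y`, half the derivative of `R²` is `R (q(a) - q(b))`, the sum of the two crease curvatures,
so `R²` minus twice their primitives is constant. -/
theorem facetSign_sq (hq : IsCreaseProfile K d q) (hd8 : d ≤ 1 / 8) (x y : ℝ) :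
    facetSign q (x, y) ^ 2 = 1 / 16 + 2 * creaseCurvInt q (y + creaseLine x)
      + 2 * creaseCurvInt q (y + (-1 / 2 - creaseLine x)) := by
  have hder : ∀ t, HasDerivAt (fun t => facetSign q (x, t) ^ 2
      - 2 * creaseCurvInt q (t + creaseLine x)
      - 2 * creaseCurvInt q (t - 1 / 2 - creaseLine x)) 0 t := by
    intro t
    have h0 := (hq.hasDerivAt_facetSign_snd x t).pow 2
    have h1 := ((hq.hasDerivAt_curvInt (t + creaseLine x)).comp t
      (hasDerivAt_first_snd x t)).const_mul 2
    have h2 := ((hq.hasDerivAt_curvInt (t - 1 / 2 - creaseLine x)).comp t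
      (hasDerivAt_second_snd x t)).const_mul 2
    refine ((h0.sub h1).sub h2).congr_deriv ?_
    obtain ⟨-, e2, e3⟩ := hq.facetSign_mul hd8 (x, t)
    simp only at e2 e3
    norm_num
    linear_combination 2 * e2 - 2 * e3
  -- At height `y = 1/4` both arguments lie on plateaus for every `x`, so the constant can be read
  -- off there as `(1/4)²`.
  have hconst := is_const_of_deriv_eq_zero (fun t => (hder t).differentiableAt)
    (fun t => (hder t).deriv) y (1 / 4)
  have hb := abs_le.1 (abs_creaseLine_le x)
  have p1 : |1 / 4 + creaseLine x - ((0 : ℤ) + 1 / 2)| ≤ 1 / 2 - d := by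
    rw [abs_le]; push_cast; constructor <;> linarith
  have p2 : |1 / 4 - 1 / 2 - creaseLine x - ((-1 : ℤ) + 1 / 2)| ≤ 1 / 2 - d := by
    rw [abs_le]; push_cast; constructor <;> linarith
  have hf : facetSign q (x, 1 / 4) = 1 / 4 := by
    simp only [facetSign, hq.slope_plateau p1, hq.slope_plateau p2]
    norm_num
  rw [hf, hq.curvInt_plateau p1, hq.curvInt_plateau p2] at hconst
  rw [show y + (-1 / 2 - creaseLine x) = y - 1 / 2 - creaseLine x by ring]
  linarith

theorem integral_dx_deflection_sq (hq : IsCreaseProfile K d q) (hd8 : d ≤ 1 / 8) :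
    ∫ p in square, dx (deflection q) p ^ 2
      = Real.pi ^ 2 / 32 * (1 / 16 + 4 * creaseMean q) := by
  have hA := hq.contDiff_curvInt.continuous
  have hi : ∀ a u v, IntervalIntegrable (fun y => 2 * creaseCurvInt q (y + a)) volume u v :=
    fun a u v => (continuous_const.mul (hA.comp (by fun_prop))).intervalIntegrable _ _
  have hc : Continuous fun p => dx (deflection q) p ^ 2 :=
    (contDiff_dx hq.contDiff_deflection).continuous.pow 2
  rw [integral_square hc, hq.dx_deflection,
    ← integral_creaseLine'_sq, ← intervalIntegral.integral_mul_const]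
  refine intervalIntegral.integral_congr fun x _ => ?_
  simp only [mul_pow, hq.facetSign_sq hd8]
  rw [intervalIntegral.integral_const_mul, intervalIntegral.integral_add
    ((continuous_const.intervalIntegrable _ _).add (hi _ _ _)) (hi _ _ _),
    intervalIntegral.integral_add (continuous_const.intervalIntegrable _ _) (hi _ _ _),
    intervalIntegral.integral_const_mul, intervalIntegral.integral_const_mul,
    integral_comp_add_const_period hq.periodic_curvInt,
    integral_comp_add_const_period hq.periodic_curvInt, intervalIntegral.integral_const,
    ← creaseMean]
  norm_num
  left
  ring

theorem abs_lap_deflection_le (hq : IsCreaseProfile K d q) (p : ℝ × ℝ) :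
    |lap (deflection q) p|
      ≤ 3 + 2 * (q (p.2 + creaseLine p.1) + q (p.2 - 1 / 2 - creaseLine p.1)) := by
  have h1 : |creaseLine'' p.1 * facetSign q p| ≤ 2 := by
    rw [abs_mul]
    have := mul_le_mul (abs_creaseLine''_le p.1) (hq.abs_facetSign_le p) (abs_nonneg _)
      (by norm_num)
    linarith
  have h2 := creaseLine'_sq_le p.1
  have h3 := sq_nonneg (creaseLine' p.1)
  have h4 := hq.nonneg (p.2 + creaseLine p.1)
  have h5 := hq.nonneg (p.2 - 1 / 2 - creaseLine p.1)
  rw [lap, hq.dx_dx_deflection, hq.dy_dy_deflection]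
  simp only
  rw [abs_le] at h1 ⊢
  constructor <;> nlinarith [mul_nonneg h3 (add_nonneg h4 h5)]

/-- With `Q = q(a) + q(b)`, use `(3 + 2Q)² ≤ 18 + 8Q²`. Disjointness of the creases and the height
bound give `Q² ≤ (K/d) Q`, which is linear in `q` and integrates to its mass. -/
theorem lap_deflection_sq_le (hq : IsCreaseProfile K d q) (hd8 : d ≤ 1 / 8) (p : ℝ × ℝ) :
    lap (deflection q) p ^ 2 ≤ 18 + 8 * (K / d)
      * (q (p.2 + creaseLine p.1) + q (p.2 + (-1 / 2 - creaseLine p.1))) := by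
  have h1 := hq.abs_lap_deflection_le p
  obtain ⟨h2, -, -⟩ := hq.facetSign_mul hd8 p
  rw [show p.2 + (-1 / 2 - creaseLine p.1) = p.2 - 1 / 2 - creaseLine p.1 by ring]
  have a1 := hq.nonneg (p.2 + creaseLine p.1)
  have a2 := hq.nonneg (p.2 - 1 / 2 - creaseLine p.1)
  have b1 := mul_le_mul_of_nonneg_right (hq.le (p.2 + creaseLine p.1)) a1
  have b2 := mul_le_mul_of_nonneg_right (hq.le (p.2 - 1 / 2 - creaseLine p.1)) a2
  have h3 := pow_le_pow_left₀ (abs_nonneg _) h1 2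
  rw [sq_abs] at h3
  nlinarith [sq_nonneg (3 - 2 * (q (p.2 + creaseLine p.1) + q (p.2 - 1 / 2 - creaseLine p.1)))]

theorem integral_lap_deflection_sq_le (hq : IsCreaseProfile K d q) (hd8 : d ≤ 1 / 8) :
    ∫ p in square, lap (deflection q) p ^ 2 ≤ 18 + 8 * (K / d) := by
  have hqc := hq.contDiff.continuous
  have hbc : Continuous fun p : ℝ × ℝ => 18 + 8 * (K / d)
      * (q (p.2 + creaseLine p.1) + q (p.2 + (-1 / 2 - creaseLine p.1))) := by
    have := contDiff_creaseLine.continuous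
    fun_prop
  refine (integral_mono (integrableOn_square
    ((contDiff_lap hq.contDiff_deflection).continuous.pow 2)) (integrableOn_square hbc)
    (hq.lap_deflection_sq_le hd8)).trans_eq ?_
  have hi : ∀ a u v, IntervalIntegrable (fun y => q (y + a)) volume u v :=
    fun a u v => (hqc.comp (by fun_prop)).intervalIntegrable _ _
  have hinner : ∀ x : ℝ, ∫ y in (-(1 / 2) : ℝ)..(1 / 2), (18 + 8 * (K / d)
      * (q (y + creaseLine x) + q (y + (-1 / 2 - creaseLine x)))) = 18 + 8 * (K / d) := by
    intro x
    rw [intervalIntegral.integral_add (continuous_const.intervalIntegrable _ _)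
      (((hi _ _ _).add (hi _ _ _)).const_mul _), intervalIntegral.integral_const_mul,
      intervalIntegral.integral_add (hi _ _ _) (hi _ _ _),
      integral_comp_add_const_period hq.periodic, integral_comp_add_const_period hq.periodic,
      hq.integral, intervalIntegral.integral_const]
    norm_num
  rw [integral_square hbc]
  simp only [hinner]
  rw [intervalIntegral.integral_const]
  norm_num

theorem integral_airyLoad_sq_le (hq : IsCreaseProfile K d q) (hd : 0 < d) (hd8 : d ≤ 1 / 8) :
    ∫ p in square, airyLoad q p ^ 2 ≤ 64 * d ^ 2 := by
  refine (integral_mono (integrableOn_square (hq.contDiff_airyLoad.continuous.pow 2))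
    (integrableOn_square continuous_const) fun p => ?_).trans_eq
    (integral_square_const (64 * d ^ 2))
  have h1 : |airyLoad q p| ≤ 8 * d := by
    rw [airyLoad, abs_neg, abs_mul]
    refine mul_le_mul (abs_creaseLine''_le _) ?_ (abs_nonneg _) (by norm_num)
    refine (abs_sub _ _).trans ?_
    linarith [hq.abs_potential_le hd hd8 (p.2 + creaseLine p.1),
      hq.abs_potential_le hd hd8 (p.2 - 1 / 2 - creaseLine p.1)]
  have h2 := pow_le_pow_left₀ (abs_nonneg _) h1 2
  rw [sq_abs] at h2
  change airyLoad q p ^ 2 ≤ 64 * d ^ 2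
  linarith

end IsCreaseProfile

/-- The construction at crease width `d`, with quantitative estimates. -/
theorem exists_folded_state :
    ∃ K : ℝ, 0 < K ∧ ∀ d : ℝ, 0 < d ∧ d ≤ 1 / 8 → ∃ w φ : ℝ × ℝ → ℝ,
      (ContDiff ℝ ∞ w ∧ ContDiff ℝ ∞ φ ∧ OnePeriodic w ∧ OnePeriodic φ ∧ SolvesAiry w φ ∧
        BoundaryConditions w ∧ BoundaryConditions φ) ∧
      |(∫ p in square, dx w p ^ 2) - Real.pi ^ 2 / 512| ≤ K * d ∧
      ∫ p in square, lap w p ^ 2 ≤ K * d⁻¹ ∧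
      ∫ p in square, lap φ p ^ 2 ≤ K * d ^ 2 := by
  obtain ⟨K, hK, hex⟩ := exists_isCreaseProfile
  refine ⟨64 + 8 * K, by positivity, fun d ⟨hd, hd8⟩ => ?_⟩
  obtain ⟨q, hq⟩ := hex d hd hd8
  have hew : EvenX (deflection q) := fun x y => by simp only [deflection, creaseLine_neg]
  have heg : EvenX (airyLoad q) := fun x y => by
    simp only [airyLoad, creaseLine_neg, creaseLine''_neg]
  obtain ⟨φ, hφ, hpφ, heφ, heq, hle⟩ :=
    exists_biharmonic_solution hq.contDiff_airyLoad hq.onePeriodic_airyLoad heg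
  refine ⟨deflection q, φ, ⟨hq.contDiff_deflection, hφ, hq.onePeriodic_deflection, hpφ,
    fun p => ?_, boundaryConditions_of_even hq.onePeriodic_deflection hew,
    boundaryConditions_of_even hpφ heφ⟩, ?_, ?_, ?_⟩
  · rw [heq, add_assoc, hq.bracket_deflection_add hd8, add_neg_cancel]
  · rw [hq.integral_dx_deflection_sq hd8]
    have e : Real.pi ^ 2 / 32 * (1 / 16 + 4 * creaseMean q) - Real.pi ^ 2 / 512
        = Real.pi ^ 2 / 8 * creaseMean q := by ring
    have hp : Real.pi ^ 2 / 8 ≤ 2 := by nlinarith [Real.pi_pos, Real.pi_lt_four]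
    rw [e, abs_mul, abs_of_nonneg (by positivity)]
    have := mul_le_mul hp (hq.abs_mean_le hd hd8) (abs_nonneg _) (by norm_num)
    nlinarith [mul_pos hK hd]
  · refine (hq.integral_lap_deflection_sq_le hd8).trans ?_
    have : 1 ≤ d⁻¹ := (one_le_inv₀ hd).2 (by linarith)
    rw [div_eq_mul_inv]
    nlinarith
  · refine hle.trans ((hq.integral_airyLoad_sq_le hd hd8).trans ?_)
    nlinarith [mul_pos hK (pow_pos hd 2)]

end CurvedCreases

end VonKarmanDonnell

/-! ### Passage to the limit of vanishing crease width -/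

theorem lemma3p2 :
    ∃ w φ : ℝ → ℝ × ℝ → ℝ,
      (∀ δ : ℝ, 0 < δ →
        ContDiff ℝ ∞ (w δ) ∧ ContDiff ℝ ∞ (φ δ) ∧
        VonKarmanDonnell.OnePeriodic (w δ) ∧ VonKarmanDonnell.OnePeriodic (φ δ) ∧
        VonKarmanDonnell.SolvesAiry (w δ) (φ δ) ∧
        VonKarmanDonnell.BoundaryConditions (w δ) ∧
        VonKarmanDonnell.BoundaryConditions (φ δ)) ∧
      (∃ c : ℝ, 0 < c ∧
        Tendsto (fun δ : ℝ => ∫ p in VonKarmanDonnell.square, VonKarmanDonnell.dx (w δ) p ^ 2)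
          (𝓝[>] 0) (𝓝 c)) ∧
      ((fun δ : ℝ => ∫ p in VonKarmanDonnell.square, VonKarmanDonnell.lap (w δ) p ^ 2)
        =O[𝓝[>] 0] fun δ : ℝ => δ⁻¹) ∧
      (∀ α : ℝ, 0 < α →
        (fun δ : ℝ => ∫ p in VonKarmanDonnell.square, VonKarmanDonnell.lap (φ δ) p ^ 2)
          =O[𝓝[>] 0] fun δ : ℝ => δ ^ (2 - α)) := by
  obtain ⟨K, hK, h⟩ := VonKarmanDonnell.exists_folded_state
  choose! w φ hprop hx hw hφ using h
  -- The construction needs width at most `1/8`; truncating `δ` there gives families defined for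
  -- every `δ > 0` and changes nothing in the limit.
  have hsmall : ∀ᶠ δ : ℝ in 𝓝[>] 0, (0 < δ ∧ δ ≤ 1 / 8) ∧ min δ (1 / 8) = δ := by
    filter_upwards [Ioc_mem_nhdsGT (show (0 : ℝ) < 1 / 8 by norm_num)] with δ hδ
    exact ⟨hδ, min_eq_left hδ.2⟩
  refine ⟨fun δ => w (min δ (1 / 8)), fun δ => φ (min δ (1 / 8)),
    fun δ hδ => hprop _ ⟨lt_min hδ (by norm_num), min_le_right _ _⟩,
    ⟨Real.pi ^ 2 / 512, by positivity, ?_⟩, ?_, fun α hα => ?_⟩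
  · rw [tendsto_iff_norm_sub_tendsto_zero]
    have hlim : Tendsto (fun δ : ℝ => K * δ) (𝓝[>] 0) (𝓝 0) := by
      have : Tendsto (fun δ : ℝ => K * δ) (𝓝 0) (𝓝 (K * 0)) :=
        (continuous_const.mul continuous_id).tendsto 0
      rw [mul_zero] at this
      exact this.mono_left nhdsWithin_le_nhds
    refine squeeze_zero' (Eventually.of_forall fun _ => norm_nonneg _) ?_ hlim
    filter_upwards [hsmall] with δ hδ
    rw [hδ.2]
    exact hx δ hδ.1
  · refine IsBigO.of_bound K ?_
    filter_upwards [hsmall] with δ hδ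
    rw [hδ.2, Real.norm_of_nonneg (integral_nonneg fun p => sq_nonneg _),
      Real.norm_of_nonneg (inv_nonneg.2 hδ.1.1.le)]
    exact hw δ hδ.1
  · refine IsBigO.of_bound K ?_
    filter_upwards [hsmall] with δ hδ
    rw [hδ.2, Real.norm_of_nonneg (integral_nonneg fun p => sq_nonneg _),
      Real.norm_of_nonneg (Real.rpow_nonneg hδ.1.1.le _)]
    refine (hφ δ hδ.1).trans (mul_le_mul_of_nonneg_left ?_ hK.le)
    -- The bound obtained is `K δ²`; since `δ ≤ 1`, lowering the exponent to `2 - α` only enlarges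
    -- it.
    rw [← Real.rpow_natCast]
    exact Real.rpow_le_rpow_of_exponent_ge hδ.1.1 (by linarith [hδ.1.2]) (by push_cast; linarith)
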